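/- Let $\Omega\subset\mathbb R^n$ be compact, let $\delta>0$, and write $\mathcal M^+(Z)$ and $\mathcal M(Z)$ for the finite positive and the finite signed Borel measures on $Z$. Let $\rho_0,\rho_1\in\mathcal M^+(\Omega)$. Let $\mathcal{CE}(\rho_0,\rho_1)$ be the set of triples $\mu=(\rho,\omega,\zeta)\in\mathcal M^+([0,1]\times\Omega)\times\mathcal M([0,1]\times\Omega)^n\times\mathcal M([0,1]\times\Omega)$ such that $$\int_{[0,1]\times\Omega}\partial_t\phi\,d\rho+\int_{[0,1]\times\Omega}\nabla\phi\cdot d\omega+\int_{[0,1]\times\Omega}\phi\,d\zeta=\int_\Omega\phi(1,\cdot)\,d\rho_1-\int_\Omega\phi(0,\cdot)\,d\rho_0$$ for every $\phi\in C^1([0,1]\times\Omega)$ (restrictions of $C^1$ functions on $\mathbb R\times\mathbb R^n$, with their derivatives). The WFR energy of $\mu$ is $E_\delta(\mu)=\int_{[0,1]\times\Omega} f_\delta\big(\tfrac{d\rho}{d\lambda},\tfrac{d\omega}{d\lambda},\tfrac{d\zeta}{d\lambda}\big)\,d\lambda\in[0,\infty]$, where $f_\delta(r,w,z)=\frac{\|w\|^2+\delta^2z^2}{2r}$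 if $r>0$, $f_\delta(0,0,0)=0$, $f_\delta=+\infty$ otherwise, and $\lambda$ is any positive $\sigma$-finite measure with $\rho,\omega,\zeta\ll\lambda$ (the value does not depend on $\lambda$). Let $0\le d'\le d$ be integers and let $H=(H_i)_{i=1}^d$, $H_i=(H_i^\rho,H_i^\omega,H_i^\zeta):[0,1]\times\Omega\to\mathbb R\times\mathbb R^n\times\mathbb R$, and $F=(F_i)_{i=1}^d$, $F_i:[0,1]\to\mathbb R$, be continuous. Let $\mathcal{CE}_{H,F}(\rho_0,\rho_1)$ be the set of $\mu\in\mathcal{CE}(\rho_0,\rho_1)$ such that, for each $i=1,\dots,d$, the measures disintegrate in time as $\rho=dt\otimes\rho_t$, $\omega=dt\otimes\omega_t$, $\zeta=dt\otimes\zeta_t$ with Borel families of finite (signed) measures on $\Omega$, and for a.e. $t\in[0,1]$ $$\int_\Omega H_i^\rho(t,x)\,d\rho_t(x)+\int_\Omega H_i^\omega(t,x)\cdot d\omega_t(x)+\int_\Omega H_i^\zeta(t,x)\,d\zeta_t(x)\;\begin{cases}\le F_i(t), & 1\le i\le d',\\ =F_i(t), & d'<i\le d.\end{cases}$$ If there is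 $\mu\in\mathcal{CE}_{H,F}(\rho_0,\rho_1)$ with $E_\delta(\mu)<\infty$, then there is $\mu^*\in\mathcal{CE}_{H,F}(\rho_0,\rho_1)$ with $$E_\delta(\mu^*)=\inf\{E_\delta(\mu)\mid\mu\in\mathcal{CE}_{H,F}(\rho_0,\rho_1)\}.$$ -/

import Mathlib

open MeasureTheory
open scoped unitInterval ENNReal

noncomputable section

namespace ConstrainedWFR

/-- A triple `(ρ, ω, ζ) ∈ M⁺([0,1] × Ω) × M([0,1] × Ω)ⁿ × M([0,1] × Ω)`: density, momentum and
source. Finite Borel measures on the product, no absolute continuity in time required. -/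
structure MeasTriple (n : ℕ) (Ω : Set (EuclideanSpace ℝ (Fin n))) where
  rho : FiniteMeasure (I × Ω)
  omega : Fin n → SignedMeasure (I × Ω)
  zeta : SignedMeasure (I × Ω)

variable {n : ℕ} {Ω : Set (EuclideanSpace ℝ (Fin n))}

/-- The integral `∫ f dm` of a real function against a signed measure. -/
def sint {X : Type*} [MeasurableSpace X] (m : SignedMeasure X) (f : X → ℝ) : ℝ :=
  VectorMeasure.integral m f (ContinuousLinearMap.lsmul ℝ ℝ)

/-- The set `CE(ρ₀, ρ₁)`: the continuity equation `∂ₜρ + ∇·ω = ζ` in the distributional sense with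
boundary values `ρ₀`, `ρ₁`. Elements of `C¹([0,1] × Ω)` are given by `C¹` functions on
`ℝ × ℝⁿ`, restricted to `[0,1] × Ω`. -/
def CE (ρ₀ ρ₁ : FiniteMeasure Ω) : Set (MeasTriple n Ω) :=
  {μ | ∀ φ : ℝ × EuclideanSpace ℝ (Fin n) → ℝ, ContDiff ℝ 1 φ →
    (∫ p : I × Ω, deriv (fun s : ℝ => φ (s, p.2)) p.1 ∂(μ.rho : Measure (I × Ω)))
      + (∑ j, sint (μ.omega j)
          (fun p => gradient (fun y : EuclideanSpace ℝ (Fin n) => φ (p.1, y)) p.2 j))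
      + sint μ.zeta (fun p => φ (p.1, p.2))
    = (∫ x : Ω, φ (1, x) ∂(ρ₁ : Measure Ω)) - ∫ x : Ω, φ (0, x) ∂(ρ₀ : Measure Ω)}

/-- The Wasserstein-Fisher-Rao infinitesimal cost `f_δ`. -/
def infCost (δ r : ℝ) (w : EuclideanSpace ℝ (Fin n)) (z : ℝ) : ℝ≥0∞ :=
  open Classical in
  if 0 < r then ENNReal.ofReal ((‖w‖ ^ 2 + δ ^ 2 * z ^ 2) / (2 * r))
  else if r = 0 ∧ w = 0 ∧ z = 0 then 0 else ⊤

/-- `∫ f_δ(dμ/dlam) dlam` for a reference measure `lam`. -/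
def costWrt (δ : ℝ) (μ : MeasTriple n Ω) (lam : Measure (I × Ω)) : ℝ≥0∞ :=
  ∫⁻ p, infCost δ ((μ.rho : Measure (I × Ω)).rnDeriv lam p).toReal
    (WithLp.toLp 2 fun j => (μ.omega j).rnDeriv lam p) (μ.zeta.rnDeriv lam p) ∂lam

/-- A finite measure that dominates `ρ`, all components of `ω`, and `ζ`. -/
def MeasTriple.ref (μ : MeasTriple n Ω) : Measure (I × Ω) :=
  (μ.rho : Measure (I × Ω)) + (∑ j, (μ.omega j).totalVariation) + μ.zeta.totalVariation

/-- The WFR energy of `μ`. By `costWrt_eq_energy` below, any other σ-finite reference measure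
dominating `μ` gives the same value. -/
def energy (δ : ℝ) (μ : MeasTriple n Ω) : ℝ≥0∞ := costWrt δ μ μ.ref

/-- `ρ = dt ⊗ ρ_t` for a Borel family of finite positive measures `ρ_t` on `Ω`. -/
structure IsDisintegration (ρ : FiniteMeasure (I × Ω)) (r : I → FiniteMeasure Ω) : Prop where
  measurable : ∀ B : Set Ω, MeasurableSet B → Measurable fun t => (r t : Measure Ω) B
  apply_prod : ∀ (A : Set I) (B : Set Ω), MeasurableSet A → MeasurableSet B →
    (ρ : Measure (I × Ω)) (A ×ˢ B) = ∫⁻ t in A, (r t : Measure Ω) B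

/-- `m = dt ⊗ m_t` for a Borel family of signed measures `m_t` on `Ω`. -/
structure IsSignedDisintegration (m : SignedMeasure (I × Ω)) (s : I → SignedMeasure Ω) :
    Prop where
  measurable : ∀ B : Set Ω, MeasurableSet B → Measurable fun t => s t B
  integrable : ∀ B : Set Ω, MeasurableSet B → Integrable fun t => s t B
  apply_prod : ∀ (A : Set I) (B : Set Ω), MeasurableSet A → MeasurableSet B →
    m (A ×ˢ B) = ∫ t in A, s t B

/-- `∫ h^ρ(t,·) dρ_t + ∫ h^ω(t,·)·dω_t + ∫ h^ζ(t,·) dζ_t` at a fixed time `t`, for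
`h = (h^ρ, h^ω, h^ζ)`. -/
def sliceFunctional (h : I × Ω → ℝ × EuclideanSpace ℝ (Fin n) × ℝ) (t : I)
    (r : FiniteMeasure Ω) (w : Fin n → SignedMeasure Ω) (z : SignedMeasure Ω) : ℝ :=
  (∫ x : Ω, (h (t, x)).1 ∂(r : Measure Ω))
    + (∑ j, sint (w j) fun x => (h (t, x)).2.1 j)
    + sint z fun x => (h (t, x)).2.2

/-- `μ` disintegrates in time and, for a.e. `t`, the slice functional stands in relation `R` to
`F t`. -/
def Aff (R : ℝ → ℝ → Prop) (h : I × Ω → ℝ × EuclideanSpace ℝ (Fin n) × ℝ) (F : I → ℝ) :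
    Set (MeasTriple n Ω) :=
  {μ | ∃ (r : I → FiniteMeasure Ω) (w : I → Fin n → SignedMeasure Ω) (z : I → SignedMeasure Ω),
    IsDisintegration μ.rho r ∧
    (∀ j, IsSignedDisintegration (μ.omega j) fun t => w t j) ∧
    IsSignedDisintegration μ.zeta z ∧
    ∀ᵐ t : I, R (sliceFunctional h t (r t) (w t) (z t)) (F t)}

/-- The affine equality constraint space. -/
def AffEq (h : I × Ω → ℝ × EuclideanSpace ℝ (Fin n) × ℝ) (F : I → ℝ) : Set (MeasTriple n Ω) :=
  Aff (fun a b => a = b) h F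

/-- The affine inequality constraint space. -/
def AffIneq (h : I × Ω → ℝ × EuclideanSpace ℝ (Fin n) × ℝ) (F : I → ℝ) :
    Set (MeasTriple n Ω) :=
  Aff (fun a b => a ≤ b) h F

/-- The constrained paths: the first `d'` constraints are inequalities, the remaining `d - d'`
are equalities. -/
def constrainedPaths {d : ℕ} (d' : ℕ) (H : I × Ω → Fin d → ℝ × EuclideanSpace ℝ (Fin n) × ℝ)
    (F : I → Fin d → ℝ) (ρ₀ ρ₁ : FiniteMeasure Ω) : Set (MeasTriple n Ω) :=
  {μ | μ ∈ CE ρ₀ ρ₁ ∧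
    (∀ i : Fin d, (i : ℕ) < d' → μ ∈ AffIneq (fun p => H p i) (fun t => F t i)) ∧
    (∀ i : Fin d, d' ≤ (i : ℕ) → μ ∈ AffEq (fun p => H p i) (fun t => F t i))}

/-- The optimal value `WFR_δ^{H,F}(ρ₀, ρ₁)²`. -/
def wfrSq {d : ℕ} (δ : ℝ) (d' : ℕ) (H : I × Ω → Fin d → ℝ × EuclideanSpace ℝ (Fin n) × ℝ)
    (F : I → Fin d → ℝ) (ρ₀ ρ₁ : FiniteMeasure Ω) : ℝ≥0∞ :=
  ⨅ μ ∈ constrainedPaths d' H F ρ₀ ρ₁, energy δ μ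

/-! Independence of the energy from the reference measure. -/

theorem infCost_smul (δ : ℝ) {c : ℝ} (hc : 0 ≤ c) (r : ℝ) (w : EuclideanSpace ℝ (Fin n)) (z : ℝ) :
    infCost δ (r * c) (WithLp.toLp 2 fun j => w j * c) (z * c)
      = ENNReal.ofReal c * infCost δ r w z := by
  have hw : (WithLp.toLp 2 fun j => w j * c : EuclideanSpace ℝ (Fin n)) = c • w := by
    ext j; simp [mul_comm]
  rw [hw]
  rcases hc.eq_or_lt with rfl | hc
  · simp [infCost]
  unfold infCost
  by_cases hr : 0 < r
  · rw [if_pos (by positivity), if_pos hr, ← ENNReal.ofReal_mul hc.le, norm_smul,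
      Real.norm_of_nonneg hc.le]
    congr 1
    field_simp
  · have : ¬ 0 < r * c := by
      intro h; exact hr (pos_of_mul_pos_left h hc.le)
    rw [if_neg this, if_neg hr]
    by_cases h : r = 0 ∧ w = 0 ∧ z = 0
    · rw [if_pos h, if_pos (by simp [h])]; simp
    · rw [if_neg h, if_neg (by simpa [hc.ne'] using h), ENNReal.mul_top (by simpa using hc)]

theorem signed_rnDeriv_mul {X : Type*} [MeasurableSpace X] (m : SignedMeasure X)
    (ν lam : Measure X) [SigmaFinite ν] [SigmaFinite lam] (h : m.totalVariation ≪ ν) :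
    ∀ᵐ p ∂lam, m.rnDeriv lam p = m.rnDeriv ν p * (ν.rnDeriv lam p).toReal := by
  have hp : m.toJordanDecomposition.posPart ≪ ν :=
    (Measure.absolutelyContinuous_of_le (Measure.le_add_right le_rfl)).trans h
  have hn : m.toJordanDecomposition.negPart ≪ ν :=
    (Measure.absolutelyContinuous_of_le (Measure.le_add_left le_rfl)).trans h
  filter_upwards [Measure.rnDeriv_mul_rnDeriv (κ := lam) hp,
    Measure.rnDeriv_mul_rnDeriv (κ := lam) hn] with p h1 h2
  simp only [SignedMeasure.rnDeriv, ← h1, ← h2, Pi.mul_apply, ENNReal.toReal_mul]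
  ring

theorem measurable_infCost (δ : ℝ) :
    Measurable fun q : ℝ × EuclideanSpace ℝ (Fin n) × ℝ => infCost δ q.1 q.2.1 q.2.2 := by
  unfold infCost
  refine Measurable.ite (measurableSet_lt measurable_const measurable_fst) ?_ ?_
  · fun_prop
  · refine Measurable.ite ?_ measurable_const measurable_const
    have : {q : ℝ × EuclideanSpace ℝ (Fin n) × ℝ | q.1 = 0 ∧ q.2.1 = 0 ∧ q.2.2 = 0} = {0} := by
      ext q; simp [Prod.ext_iff]
    rw [this]; exact measurableSet_singleton _

theorem costWrt_eq_energy (δ : ℝ) (μ : MeasTriple n Ω) (lam : Measure (I × Ω)) [SigmaFinite lam]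
    (hρ : (μ.rho : Measure (I × Ω)) ≪ lam) (hω : ∀ j, (μ.omega j).totalVariation ≪ lam)
    (hζ : μ.zeta.totalVariation ≪ lam) : costWrt δ μ lam = energy δ μ := by
  have hfin : ∀ m : SignedMeasure (I × Ω), IsFiniteMeasure m.totalVariation := fun m => by
    unfold SignedMeasure.totalVariation; infer_instance
  have : IsFiniteMeasure μ.ref := by unfold MeasTriple.ref; infer_instance
  have hsum : ∀ j, (μ.omega j).totalVariation ≤ ∑ j, (μ.omega j).totalVariation := fun j =>
    Finset.single_le_sum (f := fun j => (μ.omega j).totalVariation)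
      (fun _ _ => Measure.zero_le _) (Finset.mem_univ j)
  have hρr : (μ.rho : Measure (I × Ω)) ≪ μ.ref :=
    Measure.absolutelyContinuous_of_le (Measure.le_add_right (Measure.le_add_right le_rfl))
  have hωr : ∀ j, (μ.omega j).totalVariation ≪ μ.ref := fun j =>
    Measure.absolutelyContinuous_of_le (Measure.le_add_right (Measure.le_add_left (hsum j)))
  have hζr : μ.zeta.totalVariation ≪ μ.ref :=
    Measure.absolutelyContinuous_of_le (Measure.le_add_left le_rfl)
  have href : μ.ref ≪ lam := by
    intro A hA
    simp [MeasTriple.ref, hρ hA, hζ hA, fun j => hω j hA]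
  have hm : ∀ m : SignedMeasure (I × Ω), Measurable (m.rnDeriv μ.ref) := fun m =>
    SignedMeasure.measurable_rnDeriv m μ.ref
  unfold energy costWrt
  rw [← lintegral_rnDeriv_mul href]
  · refine lintegral_congr_ae ?_
    filter_upwards [Measure.rnDeriv_mul_rnDeriv (κ := lam) hρr,
      ae_all_iff.2 fun j => signed_rnDeriv_mul (μ.omega j) μ.ref lam (hωr j),
      signed_rnDeriv_mul μ.zeta μ.ref lam hζr, μ.ref.rnDeriv_lt_top lam] with p h1 h2 h3 h4
    simp only [h2, h3, ← h1, Pi.mul_apply, ENNReal.toReal_mul]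
    rw [infCost_smul δ ENNReal.toReal_nonneg _
      (WithLp.toLp 2 fun j => (μ.omega j).rnDeriv μ.ref p), ENNReal.ofReal_toReal h4.ne]
  · refine ((measurable_infCost δ).comp (f := fun p => (_, _, _)) ?_).aemeasurable
    refine (Measure.measurable_rnDeriv _ _).ennreal_toReal.prodMk (Measurable.prodMk ?_ (hm _))
    exact (WithLp.measurable_toLp 2 _).comp (measurable_pi_lambda _ fun j => hm _)

end ConstrainedWFR

end

/-!
A triple of finite energy has `ω, ζ ≪ ρ`, and its energy is `‖u‖² / 2` in `L²(ρ)` for the field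
`u = (dω/dρ, δ dζ/dρ)`. Testing the continuity equation with the primitive in time of a
nonnegative function bounds the time marginal of `ρ` by a multiple of Lebesgue measure, the
multiple depending only on `ρ₁`, `δ` and the energy. Along a minimizing sequence the masses are
therefore bounded, so `ρₖ` and `uₖρₖ` converge weakly along an ultrafilter; by Cauchy–Schwarz and
the Riesz representation theorem the limit of `uₖρₖ` is `u'ρ'` with `‖u'‖² ≤ lim ‖uₖ‖²`.

The affine constraints hold for almost every time, and weak convergence only sees continuous
functions of time. The marginal bound makes multiplication by a function `a` of time cost only
`‖a‖` in `L²(dt)`, uniformly in `k`, so continuous functions may be replaced by indicators of Borel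
sets of times; equalities and inequalities of the slice integrals then pass to the limit.
-/

noncomputable section

namespace ConstrainedWFR

open Filter Topology ProbabilityTheory

section SignedMeasure

variable {X : Type*} [MeasurableSpace X] {ρ : Measure X} {f v : X → ℝ}

theorem integrable_withDensity_ofReal_iff (hv : AEMeasurable v ρ) :
    Integrable f (ρ.withDensity fun x => ENNReal.ofReal (v x)) ↔
      Integrable (fun x => f x * max (v x) 0) ρ := by
  rw [integrable_withDensity_iff_integrable_smul₀' hv.ennreal_ofReal
    (ae_of_all _ fun _ => ENNReal.ofReal_lt_top)]
  simp only [ENNReal.toReal_ofReal', smul_eq_mul, mul_comm]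

theorem integral_withDensity_ofReal (hv : AEMeasurable v ρ) :
    ∫ x, f x ∂(ρ.withDensity fun x => ENNReal.ofReal (v x)) = ∫ x, f x * max (v x) 0 ∂ρ := by
  rw [integral_withDensity_eq_integral_toReal_smul₀ hv.ennreal_ofReal
    (ae_of_all _ fun _ => ENNReal.ofReal_lt_top)]
  simp only [ENNReal.toReal_ofReal', smul_eq_mul, mul_comm]

theorem integrable_mul_posPart (hv : AEMeasurable v ρ) (hfv : Integrable (fun x => f x * v x) ρ) :
    Integrable (fun x => f x * max (v x) 0) ρ := by
  have hpos : NullMeasurableSet {x | 0 < v x} ρ := nullMeasurableSet_lt aemeasurable_const hv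
  refine (hfv.indicator₀ hpos).congr (ae_of_all _ fun x => ?_)
  by_cases hx : 0 < v x
  · simp [hx, hx.le]
  · simp [hx, not_lt.1 hx]

theorem sint_toSignedMeasure (ν : Measure X) [IsFiniteMeasure ν] (f : X → ℝ) :
    sint ν.toSignedMeasure f = ∫ x, f x ∂ν := by
  have hflip : (ContinuousLinearMap.lsmul ℝ ℝ : ℝ →L[ℝ] ℝ →L[ℝ] ℝ)
      = (ContinuousLinearMap.lsmul ℝ ℝ : ℝ →L[ℝ] ℝ →L[ℝ] ℝ).flip := by
    ext; simp
  rw [sint, hflip, VectorMeasure.integral_toSignedMeasure]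

theorem sint_withDensityᵥ (hv : Integrable v ρ) (hfv : Integrable (fun x => f x * v x) ρ) :
    sint (ρ.withDensityᵥ v) f = ∫ x, f x * v x ∂ρ := by
  have := isFiniteMeasure_withDensity_ofReal hv.2
  have := isFiniteMeasure_withDensity_ofReal hv.neg.2
  have hpos := integrable_mul_posPart hv.aemeasurable hfv
  have hneg : Integrable (fun x => f x * max (-v x) 0) ρ :=
    integrable_mul_posPart hv.neg.aemeasurable (by simpa using hfv.neg)
  have hsub : sint (ρ.withDensityᵥ v) f
      = sint (ρ.withDensity fun x => ENNReal.ofReal (v x)).toSignedMeasure f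
        - sint (ρ.withDensity fun x => ENNReal.ofReal (-v x)).toSignedMeasure f := by
    rw [withDensityᵥ_eq_withDensity_pos_part_sub_withDensity_neg_part hv]
    refine VectorMeasure.integral_sub_vectorMeasure ?_ ?_
    · simpa [VectorMeasure.Integrable] using
        (integrable_withDensity_ofReal_iff hv.aemeasurable).2 hpos
    · simpa [VectorMeasure.Integrable] using
        (integrable_withDensity_ofReal_iff (v := fun x => -v x) hv.neg.aemeasurable).2 hneg
  rw [hsub, sint_toSignedMeasure, sint_toSignedMeasure,
    integral_withDensity_ofReal hv.aemeasurable,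
    integral_withDensity_ofReal (v := fun x => -v x) hv.neg.aemeasurable, ← integral_sub hpos hneg]
  refine integral_congr_ae (ae_of_all _ fun x => ?_)
  rcases le_total 0 (v x) with h | h <;> simp [h]

theorem totalVariation_absolutelyContinuous_iff_vector (s : SignedMeasure X) (ρ : Measure X) :
    s.totalVariation ≪ ρ ↔ s ≪ᵥ ρ.toENNRealVectorMeasure := by
  rw [SignedMeasure.absolutelyContinuous_ennreal_iff,
    VectorMeasure.ennrealToMeasure_toENNRealVectorMeasure]

theorem totalVariation_withDensityᵥ_absolutelyContinuous (ρ : Measure X) (v : X → ℝ) :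
    SignedMeasure.totalVariation (ρ.withDensityᵥ v) ≪ ρ :=
  (totalVariation_absolutelyContinuous_iff_vector _ _).2
    (Measure.withDensityᵥ_absolutelyContinuous ρ v)

theorem rnDeriv_withDensityᵥ (hv : Integrable v ρ) :
    SignedMeasure.rnDeriv (ρ.withDensityᵥ v) ρ =ᵐ[ρ] v :=
  (SignedMeasure.eq_rnDeriv 0 v hv VectorMeasure.MutuallySingular.zero_left (zero_add _).symm).symm

theorem withDensityᵥ_rnDeriv_of_absolutelyContinuous [SigmaFinite ρ] {s : SignedMeasure X}
    (h : s.totalVariation ≪ ρ) : ρ.withDensityᵥ (s.rnDeriv ρ) = s :=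
  s.withDensityᵥ_rnDeriv_eq ρ ((totalVariation_absolutelyContinuous_iff_vector s ρ).1 h)

theorem totalVariation_absolutelyContinuous_of_rnDeriv [SigmaFinite ρ] {s : SignedMeasure X}
    {lam : Measure X} [SigmaFinite lam] (hs : s.totalVariation ≪ lam) (hρ : ρ ≪ lam)
    (h : ∀ᵐ p ∂lam, ρ.rnDeriv lam p = 0 → s.rnDeriv lam p = 0) : s.totalVariation ≪ ρ := by
  rw [totalVariation_absolutelyContinuous_iff_vector]
  refine VectorMeasure.AbsolutelyContinuous.mk fun A hA hA0 => ?_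
  rw [Measure.toENNRealVectorMeasure_apply_measurable hA, ← Measure.setLIntegral_rnDeriv hρ,
    lintegral_eq_zero_iff (Measure.measurable_rnDeriv _ _)] at hA0
  rw [← withDensityᵥ_rnDeriv_of_absolutelyContinuous hs,
    withDensityᵥ_apply (SignedMeasure.integrable_rnDeriv _ _) hA]
  refine integral_eq_zero_of_ae ?_
  filter_upwards [hA0, ae_restrict_of_ae h] with p h1 h2 using h2 h1

end SignedMeasure

variable {n : ℕ} {Ω : Set (EuclideanSpace ℝ (Fin n))}

/-- Velocity–growth vectors `(v, δ g)` of a transport velocity `v ∈ ℝⁿ` and a growth rate `g`,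
rescaled so that the WFR cost of `(ρ, vρ, gρ)` per unit of mass is half the squared norm. -/
abbrev Velocity (n : ℕ) : Type := WithLp 2 (EuclideanSpace ℝ (Fin n) × ℝ)

section Velocity

variable {Y : Type*} [MeasurableSpace Y]

/-- The `j`-th component of the momentum `ω = vρ` of a field `u = (v, δ g)`. -/
def momentum (ρ : Measure Y) (u : Y → Velocity n) (j : Fin n) : SignedMeasure Y :=
  ρ.withDensityᵥ fun y => (u y).fst j

/-- The source `ζ = gρ` of a field `u = (v, δ g)`. -/
def source (δ : ℝ) (ρ : Measure Y) (u : Y → Velocity n) : SignedMeasure Y :=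
  ρ.withDensityᵥ fun y => δ⁻¹ * (u y).snd

/-- The triple `(ρ, vρ, gρ)` with `u = (v, δ g)`. -/
def ofVelocity (δ : ℝ) (ρ : FiniteMeasure (I × Ω)) (u : I × Ω → Velocity n) : MeasTriple n Ω where
  rho := ρ
  omega := momentum (ρ : Measure (I × Ω)) u
  zeta := source δ (ρ : Measure (I × Ω)) u

theorem integrable_momentum_density {ρ : Measure Y} {u : Y → Velocity n} (hu : Integrable u ρ)
    (j : Fin n) : Integrable (fun y => (u y).fst j) ρ :=
  hu.prodLp_fst.eval_piLp j

theorem integrable_source_density (δ : ℝ) {ρ : Measure Y} {u : Y → Velocity n}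
    (hu : Integrable u ρ) : Integrable (fun y => δ⁻¹ * (u y).snd) ρ :=
  hu.prodLp_snd.const_mul δ⁻¹

end Velocity

theorem infCost_one_velocity {δ : ℝ} (hδ : δ ≠ 0) (u : Velocity n) :
    infCost δ 1 u.fst (δ⁻¹ * u.snd) = ENNReal.ofReal (‖u‖ ^ 2 / 2) := by
  rw [infCost, if_pos one_pos, WithLp.prod_norm_sq_eq_of_L2, Real.norm_eq_abs, sq_abs]
  field_simp

theorem energy_ofVelocity {δ : ℝ} (hδ : δ ≠ 0) {ρ : FiniteMeasure (I × Ω)}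
    {u : I × Ω → Velocity n} (hu : Integrable u (ρ : Measure (I × Ω))) :
    energy δ (ofVelocity δ ρ u)
      = ∫⁻ p, ENNReal.ofReal (‖u p‖ ^ 2 / 2) ∂(ρ : Measure (I × Ω)) := by
  rw [← costWrt_eq_energy δ (ofVelocity δ ρ u) (ρ : Measure (I × Ω)) .rfl
    (fun _ => totalVariation_withDensityᵥ_absolutelyContinuous _ _)
    (totalVariation_withDensityᵥ_absolutelyContinuous _ _)]
  refine lintegral_congr_ae ?_
  filter_upwards [Measure.rnDeriv_self (ρ : Measure (I × Ω)),
    ae_all_iff.2 fun j => rnDeriv_withDensityᵥ (integrable_momentum_density hu j),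
    rnDeriv_withDensityᵥ (integrable_source_density δ hu)] with p hρ hω hζ
  simp only [ofVelocity, momentum, source, hρ, hω, hζ, ENNReal.toReal_one]
  exact infCost_one_velocity hδ (u p)

theorem memLp_two_of_energy_lt_top {δ : ℝ} (hδ : δ ≠ 0) {ρ : FiniteMeasure (I × Ω)}
    {u : I × Ω → Velocity n} (hu : Integrable u (ρ : Measure (I × Ω)))
    (h : energy δ (ofVelocity δ ρ u) < ⊤) : MemLp u 2 (ρ : Measure (I × Ω)) := by
  rw [energy_ofVelocity hδ hu,
    ← hasFiniteIntegral_iff_ofReal (ae_of_all _ fun p => by positivity)] at h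
  rw [memLp_two_iff_integrable_sq_norm hu.1]
  have hhalf : Integrable (fun p => ‖u p‖ ^ 2 / 2) (ρ : Measure (I × Ω)) :=
    ⟨(hu.1.norm.pow 2).mul_const 2⁻¹, h⟩
  simpa using hhalf.mul_const 2

theorem energy_ofVelocity_eq_ofReal {δ : ℝ} (hδ : δ ≠ 0) {ρ : FiniteMeasure (I × Ω)}
    {u : I × Ω → Velocity n} (hu : MemLp u 2 (ρ : Measure (I × Ω))) :
    energy δ (ofVelocity δ ρ u) = ENNReal.ofReal ((∫ p, ‖u p‖ ^ 2 ∂(ρ : Measure (I × Ω))) / 2) := by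
  rw [energy_ofVelocity hδ (hu.integrable one_le_two), ← integral_div,
    ofReal_integral_eq_lintegral_ofReal ((hu.integrable_norm_pow two_ne_zero).div_const 2)
      (ae_of_all _ fun p => by positivity)]

theorem rho_absolutelyContinuous_ref (μ : MeasTriple n Ω) : (μ.rho : Measure (I × Ω)) ≪ μ.ref :=
  Measure.absolutelyContinuous_of_le (Measure.le_add_right (Measure.le_add_right le_rfl))

theorem omega_absolutelyContinuous_ref (μ : MeasTriple n Ω) (j : Fin n) :
    (μ.omega j).totalVariation ≪ μ.ref :=
  Measure.absolutelyContinuous_of_le (Measure.le_add_right (Measure.le_add_left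
    (Finset.single_le_sum (f := fun j => (μ.omega j).totalVariation)
      (fun _ _ => Measure.zero_le _) (Finset.mem_univ j))))

theorem zeta_absolutelyContinuous_ref (μ : MeasTriple n Ω) : μ.zeta.totalVariation ≪ μ.ref :=
  Measure.absolutelyContinuous_of_le (Measure.le_add_left le_rfl)

instance (μ : MeasTriple n Ω) : IsFiniteMeasure μ.ref := by
  unfold MeasTriple.ref; infer_instance

theorem ae_rnDeriv_ref_eq_zero_of_energy_lt_top {δ : ℝ} {μ : MeasTriple n Ω}
    (h : energy δ μ < ⊤) : ∀ᵐ p ∂μ.ref, (μ.rho : Measure (I × Ω)).rnDeriv μ.ref p = 0 →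
      (∀ j, (μ.omega j).rnDeriv μ.ref p = 0) ∧ μ.zeta.rnDeriv μ.ref p = 0 := by
  have hmeas : Measurable fun p => infCost δ ((μ.rho : Measure (I × Ω)).rnDeriv μ.ref p).toReal
      (WithLp.toLp 2 fun j => (μ.omega j).rnDeriv μ.ref p) (μ.zeta.rnDeriv μ.ref p) := by
    refine (measurable_infCost δ).comp (f := fun p => (_, _, _)) ?_
    refine (Measure.measurable_rnDeriv _ _).ennreal_toReal.prodMk
      (Measurable.prodMk ?_ (SignedMeasure.measurable_rnDeriv _ _))
    exact (WithLp.measurable_toLp 2 _).comp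
      (measurable_pi_lambda _ fun j => SignedMeasure.measurable_rnDeriv _ _)
  filter_upwards [ae_lt_top hmeas h.ne] with p hp h0
  simp only [infCost, h0, ENNReal.toReal_zero, lt_irrefl, if_false, true_and] at hp
  split_ifs at hp with hc
  · exact ⟨fun j => by simpa using congrArg (fun w : EuclideanSpace ℝ (Fin n) => w j) hc.1, hc.2⟩
  · exact absurd hp (lt_irrefl _)

theorem omega_absolutelyContinuous_rho {δ : ℝ} {μ : MeasTriple n Ω} (h : energy δ μ < ⊤)
    (j : Fin n) : (μ.omega j).totalVariation ≪ (μ.rho : Measure (I × Ω)) :=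
  totalVariation_absolutelyContinuous_of_rnDeriv (omega_absolutelyContinuous_ref μ j)
    (rho_absolutelyContinuous_ref μ)
    ((ae_rnDeriv_ref_eq_zero_of_energy_lt_top h).mono fun _ hp h0 => (hp h0).1 j)

theorem zeta_absolutelyContinuous_rho {δ : ℝ} {μ : MeasTriple n Ω} (h : energy δ μ < ⊤) :
    μ.zeta.totalVariation ≪ (μ.rho : Measure (I × Ω)) :=
  totalVariation_absolutelyContinuous_of_rnDeriv (zeta_absolutelyContinuous_ref μ)
    (rho_absolutelyContinuous_ref μ)
    ((ae_rnDeriv_ref_eq_zero_of_energy_lt_top h).mono fun _ hp h0 => (hp h0).2)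

/-- The field `(dω/dρ, δ dζ/dρ)`, from which `ofVelocity` recovers a triple with `ω, ζ ≪ ρ`. -/
def velocity (δ : ℝ) (μ : MeasTriple n Ω) (p : I × Ω) : Velocity n :=
  WithLp.toLp 2 (WithLp.toLp 2 fun j => (μ.omega j).rnDeriv (μ.rho : Measure (I × Ω)) p,
    δ * μ.zeta.rnDeriv (μ.rho : Measure (I × Ω)) p)

theorem stronglyMeasurable_velocity (δ : ℝ) (μ : MeasTriple n Ω) :
    StronglyMeasurable (velocity δ μ) := by
  refine (WithLp.prod_continuous_toLp 2 _ _).comp_stronglyMeasurable (.prodMk ?_ ?_)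
  · exact ((WithLp.measurable_toLp 2 _).comp (measurable_pi_lambda _ fun j =>
      SignedMeasure.measurable_rnDeriv _ _)).stronglyMeasurable
  · exact ((SignedMeasure.measurable_rnDeriv _ _).const_mul δ).stronglyMeasurable

theorem integrable_velocity (δ : ℝ) (μ : MeasTriple n Ω) :
    Integrable (velocity δ μ) (μ.rho : Measure (I × Ω)) :=
  .of_fst_of_snd_prodLp ⟨.of_eval_piLp fun _ => SignedMeasure.integrable_rnDeriv _ _,
    (SignedMeasure.integrable_rnDeriv _ _).const_mul δ⟩

theorem ofVelocity_velocity {δ : ℝ} (hδ : δ ≠ 0) {μ : MeasTriple n Ω} (h : energy δ μ < ⊤) :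
    ofVelocity δ μ.rho (velocity δ μ) = μ := by
  have hω : momentum (μ.rho : Measure (I × Ω)) (velocity δ μ) = μ.omega := funext fun j =>
    withDensityᵥ_rnDeriv_of_absolutelyContinuous (omega_absolutelyContinuous_rho h j)
  have hζ : source δ (μ.rho : Measure (I × Ω)) (velocity δ μ) = μ.zeta := by
    simp only [source, velocity, WithLp.toLp_snd, inv_mul_cancel_left₀ hδ]
    exact withDensityᵥ_rnDeriv_of_absolutelyContinuous (zeta_absolutelyContinuous_rho h)
  rw [ofVelocity, hω, hζ]

theorem memLp_velocity {δ : ℝ} (hδ : δ ≠ 0) {μ : MeasTriple n Ω} (h : energy δ μ < ⊤) :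
    MemLp (velocity δ μ) 2 (μ.rho : Measure (I × Ω)) :=
  memLp_two_of_energy_lt_top hδ (integrable_velocity δ μ) ((ofVelocity_velocity hδ h).symm ▸ h)

section Pairing

/-- The vector dual to velocities for which `⟪dualVelocity δ (w, z), (v, δ g)⟫ = w · v + z g`. -/
def dualVelocity (δ : ℝ) (q : EuclideanSpace ℝ (Fin n) × ℝ) : Velocity n :=
  WithLp.toLp 2 (q.1, δ⁻¹ * q.2)

theorem continuous_dualVelocity (δ : ℝ) :
    Continuous (dualVelocity δ : EuclideanSpace ℝ (Fin n) × ℝ → Velocity n) :=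
  (WithLp.prod_continuous_toLp 2 _ _).comp (by fun_prop)

theorem inner_dualVelocity (δ : ℝ) (q : EuclideanSpace ℝ (Fin n) × ℝ) (u : Velocity n) :
    inner ℝ (dualVelocity δ q) u = ∑ j, q.1 j * u.fst j + q.2 * (δ⁻¹ * u.snd) := by
  simp only [dualVelocity, WithLp.prod_inner_apply, PiLp.inner_apply, RCLike.inner_apply,
    conj_trivial, WithLp.fst, WithLp.snd, mul_comm, mul_left_comm]

/-- The density `a + w · v + z g` with respect to `ρ` of `a dρ + w · dω + z dζ`, where
`ω = vρ`, `ζ = gρ` and `u = (v, δ g)`. -/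
def pairing (δ : ℝ) (h : ℝ × EuclideanSpace ℝ (Fin n) × ℝ) (u : Velocity n) : ℝ :=
  h.1 + inner ℝ (dualVelocity δ h.2) u

variable {Y : Type*} [TopologicalSpace Y] [CompactSpace Y] [MeasurableSpace Y]
  [OpensMeasurableSpace Y] {ρ : Measure Y}

theorem integrable_continuous_mul {f v : Y → ℝ} (hf : Continuous f) (hv : Integrable v ρ) :
    Integrable (fun y => f y * v y) ρ :=
  hv.bdd_mul hf.aestronglyMeasurable (ae_of_all _ (ContinuousMap.mk f hf).norm_coe_le_norm)

theorem integrable_inner_continuous {W : Type*} [NormedAddCommGroup W] [InnerProductSpace ℝ W]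
    [SecondCountableTopologyEither Y W] {b u : Y → W} (hb : Continuous b) (hu : Integrable u ρ) :
    Integrable (fun y => inner ℝ (b y) (u y)) ρ :=
  (integrable_continuous_mul hb.norm hu.norm).mono' (hb.aestronglyMeasurable.inner hu.1)
    (ae_of_all _ fun _ => norm_inner_le_norm _ _)

theorem integrable_pairing [IsFiniteMeasure ρ] (δ : ℝ)
    {h : Y → ℝ × EuclideanSpace ℝ (Fin n) × ℝ} (hh : Continuous h) {u : Y → Velocity n}
    (hu : Integrable u ρ) : Integrable (fun y => pairing δ (h y) (u y)) ρ :=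
  (by simpa using integrable_continuous_mul hh.fst (integrable_const (1 : ℝ)) :
    Integrable (fun y => (h y).1) ρ).add
    (integrable_inner_continuous ((continuous_dualVelocity δ).comp hh.snd) hu)

theorem integral_pairing [IsFiniteMeasure ρ] (δ : ℝ)
    {h : Y → ℝ × EuclideanSpace ℝ (Fin n) × ℝ} (hh : Continuous h) {u : Y → Velocity n}
    (hu : Integrable u ρ) :
    ∫ y, pairing δ (h y) (u y) ∂ρ = (∫ y, (h y).1 ∂ρ)
      + (∑ j, sint (momentum ρ u j) fun y => (h y).2.1 j)
      + sint (source δ ρ u) fun y => (h y).2.2 := by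
  have hω (j : Fin n) : Integrable (fun y => (h y).2.1 j * (u y).fst j) ρ :=
    integrable_continuous_mul (by fun_prop) (integrable_momentum_density hu j)
  have hζ : Integrable (fun y => (h y).2.2 * (δ⁻¹ * (u y).snd)) ρ :=
    integrable_continuous_mul (by fun_prop) (integrable_source_density δ hu)
  have hρ : Integrable (fun y => (h y).1) ρ := by
    simpa using integrable_continuous_mul hh.fst (integrable_const (1 : ℝ))
  simp only [pairing, inner_dualVelocity, momentum, source,
    sint_withDensityᵥ (integrable_momentum_density hu _) (hω _),
    sint_withDensityᵥ (integrable_source_density δ hu) hζ]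
  have hωζ : Integrable (fun y => ∑ j, (h y).2.1 j * (u y).fst j
      + (h y).2.2 * (δ⁻¹ * (u y).snd)) ρ := (integrable_finsetSum _ fun j _ => hω j).add hζ
  rw [integral_add hρ hωζ, integral_add (integrable_finsetSum _ fun j _ => hω j) hζ,
    integral_finsetSum _ fun j _ => hω j, add_assoc]

end Pairing

section ContinuityEquation

/-- `(∂ₜφ, ∇φ, φ)` on `[0,1] × Ω`. -/
def spaceTimeJet (φ : ℝ × EuclideanSpace ℝ (Fin n) → ℝ) (p : I × Ω) :
    ℝ × EuclideanSpace ℝ (Fin n) × ℝ :=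
  (deriv (fun s : ℝ => φ (s, p.2)) p.1,
    gradient (fun y : EuclideanSpace ℝ (Fin n) => φ (p.1, y)) p.2, φ (p.1, p.2))

theorem continuous_spaceTimeJet {φ : ℝ × EuclideanSpace ℝ (Fin n) → ℝ} (hφ : ContDiff ℝ 1 φ) :
    Continuous (spaceTimeJet φ : I × Ω → _) := by
  have hd (p : I × Ω) : HasFDerivAt φ (fderiv ℝ φ (p.1, p.2)) ((p.1 : ℝ), (p.2 : _)) :=
    (hφ.differentiable one_ne_zero _).hasFDerivAt
  have htime (p : I × Ω) : deriv (fun s : ℝ => φ (s, p.2)) p.1 = fderiv ℝ φ (p.1, p.2) (1, 0) :=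
    ((hd p).comp_hasDerivAt (p.1 : ℝ)
      ((hasDerivAt_id (p.1 : ℝ)).prodMk (hasDerivAt_const (p.1 : ℝ) _))).deriv
  have hspace (p : I × Ω) : fderiv ℝ (fun y : EuclideanSpace ℝ (Fin n) => φ (p.1, y)) p.2
      = (fderiv ℝ φ (p.1, p.2)).comp (ContinuousLinearMap.inr ℝ ℝ _) :=
    ((hd p).comp (p.2 : EuclideanSpace ℝ (Fin n))
      ((hasFDerivAt_const (p.1 : ℝ) _).prodMk (hasFDerivAt_id _))).fderiv
  change Continuous fun p => spaceTimeJet φ p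
  simp only [spaceTimeJet, gradient, htime, hspace]
  have := hφ.continuous
  have := hφ.continuous_fderiv one_ne_zero
  fun_prop

theorem ofVelocity_mem_CE_iff [CompactSpace Ω] {δ : ℝ} {ρ : FiniteMeasure (I × Ω)}
    {u : I × Ω → Velocity n} (hu : Integrable u (ρ : Measure (I × Ω))) {ρ₀ ρ₁ : FiniteMeasure Ω} :
    ofVelocity δ ρ u ∈ CE ρ₀ ρ₁ ↔ ∀ φ : ℝ × EuclideanSpace ℝ (Fin n) → ℝ, ContDiff ℝ 1 φ →
      ∫ p, pairing δ (spaceTimeJet φ p) (u p) ∂(ρ : Measure (I × Ω))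
        = (∫ x : Ω, φ (1, x) ∂(ρ₁ : Measure Ω)) - ∫ x : Ω, φ (0, x) ∂(ρ₀ : Measure Ω) := by
  refine forall₂_congr fun φ hφ => ?_
  rw [integral_pairing δ (continuous_spaceTimeJet hφ) hu]
  rfl

end ContinuityEquation

section TimeMarginal

theorem measure_le_of_forall_integral_continuous_le {Y : Type*} [TopologicalSpace Y] [T2Space Y]
    [NormalSpace Y] [MeasurableSpace Y] [BorelSpace Y] {ν₁ ν₂ : Measure Y} [IsFiniteMeasure ν₁]
    [IsFiniteMeasure ν₂] [ν₁.InnerRegularCompactLTTop] [ν₂.OuterRegular]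
    [ν₂.InnerRegularCompactLTTop]
    (h : ∀ ψ : C(Y, ℝ), 0 ≤ ψ → ∫ t, ψ t ∂ν₁ ≤ ∫ t, ψ t ∂ν₂) : ν₁ ≤ ν₂ := by
  refine Measure.le_intro fun A _ _ => ?_
  rw [A.measure_eq_iInf_isOpen ν₂]
  refine le_iInf fun U => le_iInf fun hAU => le_iInf fun hU => (measure_mono hAU).trans ?_
  rw [hU.measure_eq_biSup_integral_continuous ν₁, hU.measure_eq_biSup_integral_continuous ν₂]
  exact iSup_mono fun f => iSup_mono fun hf => iSup_mono fun _ => iSup_mono fun h0 =>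
    iSup_mono fun _ => ENNReal.ofReal_le_ofReal (h ⟨f, hf⟩ h0)

theorem integral_unitInterval_eq (ψ : C(I, ℝ)) :
    ∫ t : I, ψ t = ∫ t in (0 : ℝ)..1, Set.IccExtend zero_le_one ψ t := by
  rw [intervalIntegral.integral_of_le zero_le_one, ← integral_Icc_eq_integral_Ioc,
    ← integral_subtype_comap measurableSet_Icc]
  simp only [Set.IccExtend_val]
  rfl

/-- The primitive `t ↦ ∫₀ᵗ ψ`, extended to all of `ℝ` as a `C¹` function. -/
def timePrimitive (ψ : C(I, ℝ)) (t : ℝ) : ℝ :=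
  ∫ s in (0 : ℝ)..t, Set.IccExtend zero_le_one ψ s

theorem hasDerivAt_timePrimitive (ψ : C(I, ℝ)) (t : ℝ) :
    HasDerivAt (timePrimitive ψ) (Set.IccExtend zero_le_one ψ t) t :=
  ψ.continuous.Icc_extend'.integral_hasStrictDerivAt 0 t |>.hasDerivAt

theorem contDiff_timePrimitive (ψ : C(I, ℝ)) : ContDiff ℝ 1 (timePrimitive ψ) := by
  refine contDiff_one_iff_deriv.2
    ⟨fun t => (hasDerivAt_timePrimitive ψ t).differentiableAt, ?_⟩
  rw [show deriv (timePrimitive ψ) = _ from funext fun t => (hasDerivAt_timePrimitive ψ t).deriv]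
  exact ψ.continuous.Icc_extend'

theorem abs_timePrimitive_le {ψ : C(I, ℝ)} (hψ : 0 ≤ ψ) (t : I) :
    |timePrimitive ψ t| ≤ ∫ t, ψ t := by
  have hnonneg (s : ℝ) : 0 ≤ Set.IccExtend zero_le_one ψ s := hψ _
  rw [timePrimitive,
    abs_of_nonneg (intervalIntegral.integral_nonneg t.2.1 fun s _ => hnonneg s),
    integral_unitInterval_eq]
  exact intervalIntegral.integral_mono_interval le_rfl t.2.1 t.2.2 (ae_of_all _ hnonneg)
    (ψ.continuous.Icc_extend'.intervalIntegrable _ _)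

variable {δ : ℝ} {ρ : FiniteMeasure (I × Ω)} {u : I × Ω → Velocity n}

theorem integral_abs_source_density_le (hu : MemLp u 2 (ρ : Measure (I × Ω))) {E : ℝ}
    (hE : ∫ p, ‖u p‖ ^ 2 ∂(ρ : Measure (I × Ω)) ≤ 2 * E) :
    ∫ p, |δ⁻¹ * (u p).snd| ∂(ρ : Measure (I × Ω))
      ≤ (ρ : Measure (I × Ω)).real Set.univ / 2 + δ⁻¹ ^ 2 * E := by
  have hsq := hu.integrable_norm_pow two_ne_zero
  have hYoung (p : I × Ω) : |δ⁻¹ * (u p).snd| ≤ 1 / 2 + δ⁻¹ ^ 2 / 2 * ‖u p‖ ^ 2 := by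
    have hsnd : |(u p).snd| ^ 2 ≤ ‖u p‖ ^ 2 := by
      gcongr; exact WithLp.norm_snd_le _ (u p)
    have habs : |δ⁻¹ * (u p).snd| ^ 2 = δ⁻¹ ^ 2 * |(u p).snd| ^ 2 := by
      rw [abs_mul, mul_pow, sq_abs δ⁻¹]
    nlinarith [sq_nonneg (|δ⁻¹ * (u p).snd| - 1), mul_le_mul_of_nonneg_left hsnd (sq_nonneg δ⁻¹)]
  calc ∫ p, |δ⁻¹ * (u p).snd| ∂(ρ : Measure (I × Ω))
    _ ≤ ∫ p, (1 / 2 + δ⁻¹ ^ 2 / 2 * ‖u p‖ ^ 2) ∂(ρ : Measure (I × Ω)) :=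
        integral_mono (integrable_source_density δ (hu.integrable one_le_two)).abs
          ((integrable_const _).add (hsq.const_mul _)) hYoung
    _ = (ρ : Measure (I × Ω)).real Set.univ / 2
          + δ⁻¹ ^ 2 / 2 * ∫ p, ‖u p‖ ^ 2 ∂(ρ : Measure (I × Ω)) := by
        rw [integral_add (integrable_const _) (hsq.const_mul _), integral_const_mul,
          integral_const, smul_eq_mul, mul_one_div]
    _ ≤ _ := by nlinarith [mul_le_mul_of_nonneg_left hE (sq_nonneg δ⁻¹)]

variable [CompactSpace Ω] {ρ₀ ρ₁ : FiniteMeasure Ω}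

theorem integral_time_add_eq (hu : Integrable u (ρ : Measure (I × Ω)))
    (h : ofVelocity δ ρ u ∈ CE ρ₀ ρ₁) (ψ : C(I, ℝ)) :
    (∫ p, ψ p.1 ∂(ρ : Measure (I × Ω)))
      + ∫ p, timePrimitive ψ p.1 * (δ⁻¹ * (u p).snd) ∂(ρ : Measure (I × Ω))
      = (ρ₁ : Measure Ω).real Set.univ * ∫ t, ψ t := by
  have hΦ := contDiff_timePrimitive ψ
  have hjet (p : I × Ω) : spaceTimeJet (fun q => timePrimitive ψ q.1) p
      = (ψ p.1, 0, timePrimitive ψ p.1) := by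
    simp [spaceTimeJet, (hasDerivAt_timePrimitive ψ _).deriv, gradient]
  have hCE := (ofVelocity_mem_CE_iff hu).1 h (fun q => timePrimitive ψ q.1)
    (hΦ.comp contDiff_fst)
  simp only [hjet, pairing, inner_dualVelocity, PiLp.zero_apply, zero_mul, Finset.sum_const_zero,
    zero_add, integral_const, smul_eq_mul] at hCE
  have hψ : Integrable (fun p : I × Ω => ψ p.1) (ρ : Measure (I × Ω)) := by
    simpa using integrable_continuous_mul (f := fun p : I × Ω => ψ p.1) (by fun_prop)
      (integrable_const (1 : ℝ))
  have hΦu : Integrable (fun p => timePrimitive ψ p.1 * (δ⁻¹ * (u p).snd))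
      (ρ : Measure (I × Ω)) :=
    integrable_continuous_mul (f := fun p : I × Ω => timePrimitive ψ p.1)
      (hΦ.continuous.comp (by fun_prop)) (integrable_source_density δ hu)
  rw [← integral_add hψ hΦu, hCE, integral_unitInterval_eq]
  simp [timePrimitive]

theorem integral_time_le (hu : Integrable u (ρ : Measure (I × Ω)))
    (h : ofVelocity δ ρ u ∈ CE ρ₀ ρ₁) {ψ : C(I, ℝ)} (hψ : 0 ≤ ψ) :
    ∫ p, ψ p.1 ∂(ρ : Measure (I × Ω)) ≤ ((ρ₁ : Measure Ω).real Set.univ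
      + ∫ p, |δ⁻¹ * (u p).snd| ∂(ρ : Measure (I × Ω))) * ∫ t, ψ t := by
  have hsource : |∫ p, timePrimitive ψ p.1 * (δ⁻¹ * (u p).snd) ∂(ρ : Measure (I × Ω))|
      ≤ (∫ t, ψ t) * ∫ p, |δ⁻¹ * (u p).snd| ∂(ρ : Measure (I × Ω)) := by
    rw [← integral_const_mul]
    refine abs_integral_le_integral_abs.trans (integral_mono_of_nonneg
      (ae_of_all _ fun _ => abs_nonneg _) ((integrable_source_density δ hu).abs.const_mul _)
      (ae_of_all _ fun p => ?_))
    simp only [abs_mul (timePrimitive ψ p.1)]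
    exact mul_le_mul_of_nonneg_right (abs_timePrimitive_le hψ p.1) (abs_nonneg _)
  linarith [integral_time_add_eq hu h ψ, neg_le_of_abs_le hsource]

theorem mass_le_of_mem_CE (hu : MemLp u 2 (ρ : Measure (I × Ω)))
    (h : ofVelocity δ ρ u ∈ CE ρ₀ ρ₁) {E : ℝ}
    (hE : ∫ p, ‖u p‖ ^ 2 ∂(ρ : Measure (I × Ω)) ≤ 2 * E) :
    (ρ : Measure (I × Ω)).real Set.univ
      ≤ 2 * (ρ₁ : Measure Ω).real Set.univ + 2 * (δ⁻¹ ^ 2 * E) := by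
  have hone := integral_time_le (hu.integrable one_le_two) h (ψ := 1) zero_le_one
  simp only [ContinuousMap.one_apply, integral_const, probReal_univ, smul_eq_mul, mul_one] at hone
  linarith [integral_abs_source_density_le (δ := δ) hu hE]

theorem fst_le_of_mem_CE (hu : MemLp u 2 (ρ : Measure (I × Ω)))
    (h : ofVelocity δ ρ u ∈ CE ρ₀ ρ₁) {E : ℝ}
    (hE : ∫ p, ‖u p‖ ^ 2 ∂(ρ : Measure (I × Ω)) ≤ 2 * E) :
    (ρ : Measure (I × Ω)).fst
      ≤ (2 * (ρ₁ : Measure Ω).real Set.univ + 2 * (δ⁻¹ ^ 2 * E)).toNNReal • volume := by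
  have hmass := mass_le_of_mem_CE hu h hE
  refine measure_le_of_forall_integral_continuous_le fun ψ hψ => ?_
  rw [integral_smul_nnreal_measure, Measure.fst,
    integral_map measurable_fst.aemeasurable ψ.continuous.aestronglyMeasurable, NNReal.smul_def,
    Real.coe_toNNReal _ (measureReal_nonneg.trans hmass), smul_eq_mul]
  refine (integral_time_le (hu.integrable one_le_two) h hψ).trans
    (mul_le_mul_of_nonneg_right ?_ (integral_nonneg hψ))
  linarith [integral_abs_source_density_le (δ := δ) hu hE]

end TimeMarginal

section Disintegration

theorem isSFiniteKernel_of_isFiniteMeasure {X Z : Type*} [MeasurableSpace X] [MeasurableSpace Z]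
    (κ : Kernel X Z) (h : ∀ x, IsFiniteMeasure (κ x)) : IsSFiniteKernel κ := by
  classical
  have hmeas : Measurable fun x => ⌊(κ x Set.univ).toNNReal⌋₊ :=
    Nat.measurable_floor.comp (κ.measurable_coe .univ).ennreal_toNNReal
  have hlevel (k : ℕ) : MeasurableSet {x | ⌊(κ x Set.univ).toNNReal⌋₊ = k} :=
    hmeas (measurableSet_singleton k)
  have hfin (k : ℕ) : IsFiniteKernel (Kernel.piecewise (hlevel k) κ 0) := by
    refine ⟨k + 1, by finiteness, fun x => ?_⟩
    rw [Kernel.piecewise_apply]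
    split_ifs with hx
    · rw [← ENNReal.coe_toNNReal (measure_ne_top (κ x) Set.univ)]
      have := (Nat.lt_floor_add_one (κ x Set.univ).toNNReal).le
      rw [show ⌊_⌋₊ = k from hx] at this
      exact_mod_cast this
    · simp
  have hsum : κ = Kernel.sum fun k => Kernel.piecewise (hlevel k) κ 0 := by
    ext x B hB
    rw [Kernel.sum_apply' _ _ hB, tsum_eq_single ⌊(κ x Set.univ).toNNReal⌋₊]
    · simp [Kernel.piecewise_apply]
    · intro k hk
      simp [Kernel.piecewise_apply, hk.symm]
  rw [hsum]
  infer_instance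

/-- The transition kernel `t ↦ ρ_t` of a time disintegration. -/
def IsDisintegration.kernel {ρ : FiniteMeasure (I × Ω)} {r : I → FiniteMeasure Ω}
    (h : IsDisintegration ρ r) : Kernel I Ω where
  toFun t := r t
  measurable' := Measure.measurable_of_measurable_coe _ h.measurable

namespace IsDisintegration

variable {ρ : FiniteMeasure (I × Ω)} {r : I → FiniteMeasure Ω} (h : IsDisintegration ρ r)
include h

theorem isSFiniteKernel_kernel : IsSFiniteKernel h.kernel :=
  isSFiniteKernel_of_isFiniteMeasure _ fun t => inferInstanceAs (IsFiniteMeasure (r t : Measure Ω))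

theorem compProd_kernel : (volume : Measure I) ⊗ₘ h.kernel = ρ := by
  have := h.isSFiniteKernel_kernel
  refine (Measure.ext_prod fun {A B} hA hB => ?_).symm
  rw [Measure.compProd_apply_prod hA hB, h.apply_prod A B hA hB]
  rfl

theorem ae_integrable {E : Type*} [NormedAddCommGroup E] {v : I × Ω → E}
    (hv : Integrable v (ρ : Measure (I × Ω))) :
    ∀ᵐ t, Integrable (fun x => v (t, x)) (r t : Measure Ω) := by
  have := h.isSFiniteKernel_kernel
  rw [← h.compProd_kernel] at hv
  exact ((Measure.integrable_compProd_iff hv.1).1 hv).1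

theorem integrable_setIntegral {v : I × Ω → ℝ} (hv : Integrable v (ρ : Measure (I × Ω)))
    {B : Set Ω} (hB : MeasurableSet B) :
    Integrable fun t => ∫ x in B, v (t, x) ∂(r t : Measure Ω) := by
  have := h.isSFiniteKernel_kernel
  have hvB := hv.indicator (MeasurableSet.univ (α := I) |>.prod hB)
  rw [← h.compProd_kernel] at hvB
  have hslice := hvB.integral_compProd
  simp only [Kernel.prodMkLeft_apply, Kernel.const_apply] at hslice
  refine hslice.congr (ae_of_all _ fun t => ?_)
  simp only [← integral_indicator hB]
  exact integral_congr_ae (ae_of_all _ fun x => by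
    by_cases hx : x ∈ B <;> simp [hx])

theorem setIntegral_prod {v : I × Ω → ℝ} (hv : Integrable v (ρ : Measure (I × Ω)))
    {A : Set I} {B : Set Ω} (hA : MeasurableSet A) (hB : MeasurableSet B) :
    ∫ p in A ×ˢ B, v p ∂(ρ : Measure (I × Ω))
      = ∫ t in A, ∫ x in B, v (t, x) ∂(r t : Measure Ω) := by
  have := h.isSFiniteKernel_kernel
  rw [← h.compProd_kernel] at hv ⊢
  exact Measure.setIntegral_compProd hA hB hv.integrableOn

theorem measurable_withDensityᵥ {v : I × Ω → ℝ} (hv : StronglyMeasurable v) {B : Set Ω}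
    (hB : MeasurableSet B) :
    Measurable fun t => (r t : Measure Ω).withDensityᵥ (fun x => v (t, x)) B := by
  have := h.isSFiniteKernel_kernel
  have hint : MeasurableSet {t | Integrable (fun x => v (t, x)) (r t : Measure Ω)} :=
    measurableSet_kernel_integrable (κ := h.kernel) (f := fun t x => v (t, x)) hv
  have hslice : Measurable fun t => ∫ x in B, v (t, x) ∂(r t : Measure Ω) := by
    simp only [← integral_indicator hB]
    exact (StronglyMeasurable.integral_kernel_prod_right (κ := h.kernel)
      (f := fun t x => B.indicator (fun x => v (t, x)) x)
      (hv.indicator (measurable_snd hB))).measurable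
  convert hslice.indicator hint using 2 with t
  by_cases ht : Integrable (fun x => v (t, x)) (r t : Measure Ω)
  · rw [Set.indicator_of_mem (by exact ht), withDensityᵥ_apply ht hB]
  · rw [Set.indicator_of_notMem (by exact ht), Measure.withDensityᵥ, dif_neg ht]
    rfl

theorem withDensityᵥ {v : I × Ω → ℝ} (hv : StronglyMeasurable v)
    (hvi : Integrable v (ρ : Measure (I × Ω))) :
    IsSignedDisintegration ((ρ : Measure (I × Ω)).withDensityᵥ v)
      fun t => (r t : Measure Ω).withDensityᵥ fun x => v (t, x) where
  measurable _ hB := h.measurable_withDensityᵥ hv hB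
  integrable B hB := (h.integrable_setIntegral hvi hB).congr <|
    (h.ae_integrable hvi).mono fun t ht => (withDensityᵥ_apply ht hB).symm
  apply_prod A B hA hB := by
    rw [withDensityᵥ_apply hvi (hA.prod hB), h.setIntegral_prod hvi hA hB]
    exact setIntegral_congr_ae hA <|
      (h.ae_integrable hvi).mono fun t ht _ => (withDensityᵥ_apply ht hB).symm

end IsDisintegration

theorem exists_isDisintegration [CompactSpace Ω] {ρ : FiniteMeasure (I × Ω)}
    (hρ : (ρ : Measure (I × Ω)).fst ≪ volume) : ∃ r, IsDisintegration ρ r := by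
  rcases isEmpty_or_nonempty Ω with hΩ | hΩ
  · refine ⟨fun _ => 0, fun B _ => measurable_const, fun A B _ _ => ?_⟩
    simp [Set.eq_empty_of_isEmpty B]
  have := Measure.haveLebesgueDecomposition_of_sigmaFinite (ρ : Measure (I × Ω)).fst
    (volume : Measure I)
  let κ := (ρ : Measure (I × Ω)).condKernel
  let m (t : I) : NNReal := ((ρ : Measure (I × Ω)).fst.rnDeriv volume t).toNNReal
  have hm : Measurable m := (Measure.measurable_rnDeriv _ _).ennreal_toNNReal
  have hsmul (t : I) (B : Set Ω) : (m t • κ t) B = m t * κ t B := rfl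
  refine ⟨fun t => ⟨m t • κ t, inferInstance⟩, fun B hB => ?_, fun A B hA hB => ?_⟩
  · simp only [FiniteMeasure.toMeasure_mk, hsmul]
    exact hm.coe_nnreal_ennreal.mul (κ.measurable_coe hB)
  · calc (ρ : Measure (I × Ω)) (A ×ˢ B)
        = ∫⁻ t in A, κ t B ∂(ρ : Measure (I × Ω)).fst := by
          conv_lhs => rw [← (ρ : Measure (I × Ω)).disintegrate κ]
          exact Measure.compProd_apply_prod hA hB
      _ = ∫⁻ t in A, (ρ : Measure (I × Ω)).fst.rnDeriv volume t * κ t B :=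
          (setLIntegral_rnDeriv_mul hρ (κ.measurable_coe hB).aemeasurable hA).symm
      _ = ∫⁻ t in A, (m t • κ t) B := by
          refine lintegral_congr_ae (ae_restrict_of_ae ?_)
          filter_upwards [(ρ : Measure (I × Ω)).fst.rnDeriv_lt_top volume] with t ht
          rw [hsmul, ENNReal.coe_toNNReal ht.ne]

theorem IsSignedDisintegration.ae_eq {m : SignedMeasure (I × Ω)} {s s' : I → SignedMeasure Ω}
    (h : IsSignedDisintegration m s) (h' : IsSignedDisintegration m s') : ∀ᵐ t, s t = s' t := by
  let S := generateSetAlgebra (MeasurableSpace.countableGeneratingSet Ω)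
  have hgen : (inferInstance : MeasurableSpace Ω) = MeasurableSpace.generateFrom S := by
    rw [generateFrom_generateSetAlgebra_eq, MeasurableSpace.generateFrom_countableGeneratingSet]
  have hmeas (B) (hB : B ∈ S) : MeasurableSet B :=
    hgen.symm.le _ (MeasurableSpace.measurableSet_generateFrom hB)
  have hcount : S.Countable :=
    countable_generateSetAlgebra MeasurableSpace.countable_countableGeneratingSet
  have heq (B) (hB : B ∈ S) : ∀ᵐ t, s t B = s' t B :=
    Integrable.ae_eq_of_forall_setIntegral_eq _ _ (h.integrable B (hmeas B hB))
      (h'.integrable B (hmeas B hB)) fun A hA _ => by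
        rw [← h.apply_prod A B hA (hmeas B hB), ← h'.apply_prod A B hA (hmeas B hB)]
  filter_upwards [(ae_ball_iff hcount).2 heq] with t ht
  exact VectorMeasure.ext_of_generateFrom S ht hgen
    (fun _ hB _ hC _ => isSetAlgebra_generateSetAlgebra.inter_mem hB hC)
    (ht _ isSetAlgebra_generateSetAlgebra.univ_mem)

theorem ofVelocity_mem_Aff_iff [CompactSpace Ω] {δ : ℝ} {ρ : FiniteMeasure (I × Ω)}
    {u : I × Ω → Velocity n} (hum : StronglyMeasurable u)
    (hu : Integrable u (ρ : Measure (I × Ω))) {R : ℝ → ℝ → Prop}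
    {h : I × Ω → ℝ × EuclideanSpace ℝ (Fin n) × ℝ} (hh : Continuous h) {F : I → ℝ} :
    ofVelocity δ ρ u ∈ Aff R h F ↔ ∃ r, IsDisintegration ρ r ∧
      ∀ᵐ t, R (∫ x, pairing δ (h (t, x)) (u (t, x)) ∂(r t : Measure Ω)) (F t) := by
  have hslice {r : I → FiniteMeasure Ω} (hr : IsDisintegration ρ r) :
      ∀ᵐ t, ∫ x, pairing δ (h (t, x)) (u (t, x)) ∂(r t : Measure Ω)
        = sliceFunctional h t (r t) (fun j => momentum (r t : Measure Ω) (fun x => u (t, x)) j)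
          (source δ (r t : Measure Ω) fun x => u (t, x)) :=
    (hr.ae_integrable hu).mono fun t ht => integral_pairing δ (hh.comp (by fun_prop)) ht
  have hw {r : I → FiniteMeasure Ω} (hr : IsDisintegration ρ r) (j : Fin n) :=
    hr.withDensityᵥ (v := fun p => (u p).fst j) (by fun_prop) (integrable_momentum_density hu j)
  have hz {r : I → FiniteMeasure Ω} (hr : IsDisintegration ρ r) :=
    hr.withDensityᵥ (v := fun p => δ⁻¹ * (u p).snd)
      (((WithLp.sndL 2 ℝ _ _).continuous.comp_stronglyMeasurable hum).const_mul _)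
      (integrable_source_density δ hu)
  constructor
  · rintro ⟨r, w, z, hr, hw', hz', hR⟩
    refine ⟨r, hr, ?_⟩
    filter_upwards [hR, hslice hr, ae_all_iff.2 fun j => (hw' j).ae_eq (hw hr j),
      hz'.ae_eq (hz hr)] with t hRt hst hwt hzt
    rw [hst]
    convert hRt using 2
    · exact funext fun j => (hwt j).symm
    · exact hzt.symm
  · rintro ⟨r, hr, hR⟩
    refine ⟨r, _, _, hr, hw hr, hz hr, ?_⟩
    filter_upwards [hR, hslice hr] with t hRt hst
    exact hst ▸ hRt

end Disintegration

section WeakCompactness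

theorem norm_toLp_two {Y W : Type*} [MeasurableSpace Y] {ρ : Measure Y} [NormedAddCommGroup W]
    [InnerProductSpace ℝ W] {f : Y → W} (hf : MemLp f 2 ρ) :
    ‖hf.toLp f‖ = √(∫ y, ‖f y‖ ^ 2 ∂ρ) := by
  rw [← Real.sqrt_sq (norm_nonneg _), ← real_inner_self_eq_norm_sq, L2.inner_def]
  congr 1
  refine integral_congr_ae ?_
  filter_upwards [hf.coeFn_toLp] with y hy
  rw [hy, real_inner_self_eq_norm_sq]

theorem abs_integral_inner_le {Y W : Type*} [MeasurableSpace Y] {ρ : Measure Y}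
    [NormedAddCommGroup W] [InnerProductSpace ℝ W] {b u : Y → W} (hb : MemLp b 2 ρ)
    (hu : MemLp u 2 ρ) :
    |∫ y, inner ℝ (b y) (u y) ∂ρ| ≤ √(∫ y, ‖b y‖ ^ 2 ∂ρ) * √(∫ y, ‖u y‖ ^ 2 ∂ρ) := by
  have hinner : ∫ y, inner ℝ (b y) (u y) ∂ρ = inner ℝ (hb.toLp b) (hu.toLp u) := by
    rw [L2.inner_def]
    refine integral_congr_ae ?_
    filter_upwards [hb.coeFn_toLp, hu.coeFn_toLp] with y hby huy
    rw [hby, huy]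
  rw [hinner, ← norm_toLp_two hb, ← norm_toLp_two hu]
  exact abs_real_inner_le_norm _ _

theorem memLp_continuous {Y W : Type*} [TopologicalSpace Y] [CompactSpace Y] [MeasurableSpace Y]
    [OpensMeasurableSpace Y] [NormedAddCommGroup W] [SecondCountableTopologyEither Y W]
    (b : C(Y, W)) (p : ℝ≥0∞) (ρ : Measure Y) [IsFiniteMeasure ρ] : MemLp b p ρ :=
  MemLp.of_bound b.continuous.aestronglyMeasurable ‖b‖ (ae_of_all _ b.norm_coe_le_norm)

theorem exists_tendsto_ultrafilter_of_abs_le {ι : Type*} (l : Ultrafilter ι) {x B : ι → ℝ} {L : ℝ}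
    (hB : Tendsto B l (𝓝 L)) (hx : ∀ k, |x k| ≤ B k) : ∃ y, |y| ≤ L ∧ Tendsto x l (𝓝 y) := by
  have hbdd : ∀ᶠ k in (l : Filter ι), x k ∈ Set.Icc (-(L + 1)) (L + 1) :=
    (hB.eventually (gt_mem_nhds (lt_add_one L))).mono fun k hk => abs_le.1 ((hx k).trans hk.le)
  obtain ⟨y, -, hy⟩ := isCompact_Icc.ultrafilter_le_nhds' (l.map x) (Ultrafilter.mem_map.2 hbdd)
  exact ⟨y, le_of_tendsto_of_tendsto' (Tendsto.abs hy) hB hx, hy⟩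

variable {Y W : Type*} [TopologicalSpace Y] [CompactSpace Y] [T2Space Y] [MeasurableSpace Y]
  [BorelSpace Y] [NormedAddCommGroup W] [InnerProductSpace ℝ W]
  [SecondCountableTopologyEither Y W]

/-- Joint weak convergence of the measures `ρₖ` to `ρ'` and of the vector measures `uₖρₖ` to
`u'ρ'`, the latter tested against continuous vector fields. -/
structure WeakTendsto {ι : Type*} (l : Filter ι) (ρ : ι → FiniteMeasure Y) (u : ι → Y → W)
    (ρ' : FiniteMeasure Y) (u' : Y → W) : Prop where
  measure : Tendsto ρ l (𝓝 ρ')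
  field : ∀ b : C(Y, W), Tendsto (fun k => ∫ y, inner ℝ (b y) (u k y) ∂(ρ k : Measure Y)) l
    (𝓝 (∫ y, inner ℝ (b y) (u' y) ∂(ρ' : Measure Y)))

theorem exists_integral_inner_eq_of_bound [CompleteSpace W] (ρ : Measure Y) [IsFiniteMeasure ρ]
    [ρ.WeaklyRegular] (Λ : C(Y, W) →ₗ[ℝ] ℝ) {K : ℝ} (hK : 0 ≤ K)
    (hΛ : ∀ b, |Λ b| ≤ K * √(∫ y, ‖b y‖ ^ 2 ∂ρ)) :
    ∃ u : Y → W, StronglyMeasurable u ∧ MemLp u 2 ρ ∧ ∫ y, ‖u y‖ ^ 2 ∂ρ ≤ K ^ 2 ∧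
      ∀ b, Λ b = ∫ y, inner ℝ (b y) (u y) ∂ρ := by
  let e : C(Y, W) →L[ℝ] Lp W 2 ρ := ContinuousMap.toLp (E := W) 2 ρ ℝ
  have hnorm (b : C(Y, W)) : ‖Λ b‖ ≤ K * ‖e b‖ :=
    (hΛ b).trans_eq (congrArg (K * ·) (norm_toLp_two (memLp_continuous b 2 ρ)).symm)
  have hdense : DenseRange (e : C(Y, W) →ₗ[ℝ] Lp W 2 ρ) :=
    ContinuousMap.toLp_denseRange W ρ ℝ (by simp)
  let T : Lp W 2 ρ →L[ℝ] ℝ := Λ.extendOfNorm (e : C(Y, W) →ₗ[ℝ] Lp W 2 ρ)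
  let U : Lp W 2 ρ := (InnerProductSpace.toDual ℝ (Lp W 2 ρ)).symm T
  have hU : ‖U‖ ≤ K := by
    rw [LinearIsometryEquiv.norm_map]
    exact LinearMap.opNorm_extendOfNorm_le hdense hK hnorm
  refine ⟨U, Lp.stronglyMeasurable U, Lp.memLp U, ?_, fun b => ?_⟩
  · rw [← Real.sqrt_le_left hK, ← norm_toLp_two (Lp.memLp U), Lp.toLp_coeFn]
    exact hU
  · calc Λ b = inner ℝ U (e b) := by
          rw [InnerProductSpace.toDual_symm_apply]
          exact (LinearMap.extendOfNorm_eq hdense ⟨_, hnorm⟩ b).symm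
      _ = ∫ y, inner ℝ (b y) (U y) ∂ρ := by
          rw [real_inner_comm, L2.inner_def]
          refine integral_congr_ae ?_
          filter_upwards [ContinuousMap.coeFn_toLp (p := 2) (𝕜 := ℝ) ρ b] with y hy
          rw [hy]

theorem exists_weakTendsto [CompleteSpace W] [∀ ν : FiniteMeasure Y, (ν : Measure Y).WeaklyRegular]
    {ι : Type*} (l : Ultrafilter ι) {ρ : ι → FiniteMeasure Y} {u : ι → Y → W}
    (hu : ∀ k, MemLp (u k) 2 (ρ k : Measure Y)) {C : NNReal} (hC : ∀ k, (ρ k).mass ≤ C)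
    {e : ι → ℝ} {m : ℝ} (he : Tendsto e l (𝓝 m))
    (hE : ∀ k, ∫ y, ‖u k y‖ ^ 2 ∂(ρ k : Measure Y) ≤ e k) :
    ∃ (ρ' : FiniteMeasure Y) (u' : Y → W), StronglyMeasurable u' ∧ MemLp u' 2 (ρ' : Measure Y) ∧
      ∫ y, ‖u' y‖ ^ 2 ∂(ρ' : Measure Y) ≤ m ∧ WeakTendsto l ρ u ρ' u' := by
  obtain ⟨ρ', -, hρ'⟩ : ∃ ρ' ∈ {ν : FiniteMeasure Y | ν.mass ≤ C}, Tendsto ρ l (𝓝 ρ') :=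
    (isCompact_setOfPred_finiteMeasure_le_of_compactSpace Y C).ultrafilter_le_nhds'
      (l.map ρ) (Ultrafilter.mem_map.2 (Eventually.of_forall hC))
  have hm : 0 ≤ m := ge_of_tendsto' he fun k =>
    (integral_nonneg fun _ => by positivity).trans (hE k)
  have hinner (b : C(Y, W)) (k : ι) :
      Integrable (fun y => inner ℝ (b y) (u k y)) (ρ k : Measure Y) :=
    integrable_inner_continuous b.continuous ((hu k).integrable one_le_two)
  have hlim (b : C(Y, W)) : ∃ L, |L| ≤ √m * √(∫ y, ‖b y‖ ^ 2 ∂(ρ' : Measure Y)) ∧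
      Tendsto (fun k => ∫ y, inner ℝ (b y) (u k y) ∂(ρ k : Measure Y)) l (𝓝 L) := by
    refine exists_tendsto_ultrafilter_of_abs_le l (he.sqrt.mul (Tendsto.sqrt
      (FiniteMeasure.tendsto_iff_forall_integral_tendsto.1 hρ'
        (BoundedContinuousFunction.mkOfCompact ⟨fun y => ‖b y‖ ^ 2, by fun_prop⟩)))) fun k => ?_
    rw [mul_comm]
    exact (abs_integral_inner_le (memLp_continuous b 2 _) (hu k)).trans
      (mul_le_mul_of_nonneg_left (Real.sqrt_le_sqrt (hE k)) (Real.sqrt_nonneg _))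
  choose L hLbound hL using hlim
  let Λ : C(Y, W) →ₗ[ℝ] ℝ :=
    { toFun := L
      map_add' := fun b c => tendsto_nhds_unique (hL (b + c)) <| by
        simpa only [ContinuousMap.add_apply, inner_add_left, integral_add (hinner b _) (hinner c _)]
          using (hL b).add (hL c)
      map_smul' := fun s b => tendsto_nhds_unique (hL (s • b)) <| by
        simpa only [ContinuousMap.smul_apply, real_inner_smul_left, integral_const_mul,
          RingHom.id_apply, smul_eq_mul]
          using (hL b).const_mul s }
  obtain ⟨u', hu'm, hu', hu'E, hΛ⟩ :=
    exists_integral_inner_eq_of_bound (ρ' : Measure Y) Λ (Real.sqrt_nonneg m) hLbound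
  exact ⟨ρ', u', hu'm, hu', Real.sq_sqrt hm ▸ hu'E, hρ', fun b => hΛ b ▸ hL b⟩

end WeakCompactness

section TimeSets

theorem abs_integral_fst_mul_le {X Z : Type*} [MeasurableSpace X] [MeasurableSpace Z]
    {ρ : Measure (X × Z)} {ν : Measure X} {C : NNReal} (hρ : ρ.fst ≤ C • ν) {a : X → ℝ}
    (ha : MemLp a 2 ν) {g : X × Z → ℝ} (hg : MemLp g 2 ρ) :
    |∫ p, a p.1 * g p ∂ρ| ≤ √(C * ∫ t, a t ^ 2 ∂ν) * √(∫ p, g p ^ 2 ∂ρ) := by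
  have hafst : MemLp a 2 ρ.fst := ha.of_measure_le_smul ENNReal.coe_ne_top hρ
  have hbound : ∫ p, a p.1 ^ 2 ∂ρ ≤ C * ∫ t, a t ^ 2 ∂ν :=
    calc ∫ p, a p.1 ^ 2 ∂ρ = ∫ t, a t ^ 2 ∂ρ.fst :=
          (integral_map measurable_fst.aemeasurable (hafst.1.pow 2)).symm
      _ ≤ ∫ t, a t ^ 2 ∂(C • ν) :=
          integral_mono_measure hρ (ae_of_all _ fun _ => sq_nonneg _)
            (ha.integrable_sq.smul_measure_nnreal)
      _ = C * ∫ t, a t ^ 2 ∂ν := integral_smul_nnreal_measure _ _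
  have hCS := abs_integral_inner_le (hafst.comp_of_map measurable_fst.aemeasurable) hg
  simp only [Function.comp_apply, Real.inner_apply, Real.norm_eq_abs, sq_abs] at hCS
  exact hCS.trans (by gcongr)

variable {X Z : Type*} [TopologicalSpace X] [MeasurableSpace X] [BorelSpace X] [MeasurableSpace Z]

theorem exists_continuous_integral_sq_sub_indicator_le [NormalSpace X] (ν : Measure X)
    [IsFiniteMeasure ν] [ν.WeaklyRegular] {A : Set X} (hA : MeasurableSet A) {ε : ℝ} (hε : 0 < ε) :
    ∃ ψ : C(X, ℝ), ∫ t, (A.indicator 1 t - ψ t) ^ 2 ∂ν ≤ ε ^ 2 := by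
  have hind : MemLp (A.indicator (1 : X → ℝ)) 2 ν := (memLp_const 1).indicator hA
  obtain ⟨ψ, hψ, hψ2⟩ := hind.exists_boundedContinuous_eLpNorm_sub_le (by simp)
    (ENNReal.ofReal_pos.2 hε).ne'
  refine ⟨ψ.toContinuousMap, ?_⟩
  have hnorm := norm_toLp_two (hind.sub hψ2)
  rw [Lp.norm_toLp] at hnorm
  simp only [Pi.sub_apply, Real.norm_eq_abs, sq_abs] at hnorm
  exact (Real.sqrt_le_left hε.le).1 (hnorm ▸ ENNReal.toReal_le_of_le_ofReal hε.le hψ)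

theorem abs_setIntegral_sub_integral_continuous_mul_le [CompactSpace X] {ρ : Measure (X × Z)}
    [IsFiniteMeasure ρ] {ν : Measure X} [IsFiniteMeasure ν] {C : NNReal} (hρ : ρ.fst ≤ C • ν)
    {g : X × Z → ℝ} (hg : MemLp g 2 ρ) {A : Set X} (hA : MeasurableSet A) (ψ : C(X, ℝ)) :
    |∫ p in A ×ˢ Set.univ, g p ∂ρ - ∫ p, ψ p.1 * g p ∂ρ|
      ≤ √(C * ∫ t, (A.indicator 1 t - ψ t) ^ 2 ∂ν) * √(∫ p, g p ^ 2 ∂ρ) := by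
  have hψ : MemLp (fun t => A.indicator 1 t - ψ t) 2 ν :=
    MemLp.sub (f := A.indicator (1 : X → ℝ)) ((memLp_const 1).indicator hA)
      (memLp_continuous ψ 2 ν)
  have hψg : Integrable (fun p => ψ p.1 * g p) ρ :=
    (hg.integrable one_le_two).bdd_mul
      (ψ.continuous.measurable.comp measurable_fst).aestronglyMeasurable
      (ae_of_all _ fun p => ψ.norm_coe_le_norm p.1)
  rw [← integral_indicator (hA.prod .univ), ← integral_sub
    ((hg.integrable one_le_two).indicator (hA.prod .univ)) hψg]
  convert abs_integral_fst_mul_le hρ hψ hg using 5 with p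
  by_cases hp : p.1 ∈ A <;> simp [hp, sub_mul]

theorem tendsto_setIntegral_of_tendsto_integral_continuous_mul [CompactSpace X] [NormalSpace X]
    {ι : Type*} {l : Filter ι} {ν : Measure X} [IsFiniteMeasure ν] [ν.WeaklyRegular]
    {C : NNReal} {K : ℝ} {ρ : ι → Measure (X × Z)} [∀ k, IsFiniteMeasure (ρ k)]
    (hρ : ∀ k, (ρ k).fst ≤ C • ν) {g : ι → X × Z → ℝ} (hg : ∀ k, MemLp (g k) 2 (ρ k))
    (hgK : ∀ k, ∫ p, g k p ^ 2 ∂ρ k ≤ K)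
    {ρ' : Measure (X × Z)} [IsFiniteMeasure ρ'] (hρ' : ρ'.fst ≤ C • ν)
    {g' : X × Z → ℝ} (hg' : MemLp g' 2 ρ')
    (h : ∀ ψ : C(X, ℝ), Tendsto (fun k => ∫ p, ψ p.1 * g k p ∂ρ k) l
      (𝓝 (∫ p, ψ p.1 * g' p ∂ρ')))
    {A : Set X} (hA : MeasurableSet A) :
    Tendsto (fun k => ∫ p in A ×ˢ Set.univ, g k p ∂ρ k) l
      (𝓝 (∫ p in A ×ˢ Set.univ, g' p ∂ρ')) := by
  refine Metric.tendsto_nhds.2 fun ε hε => ?_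
  set K' := max K (∫ p, g' p ^ 2 ∂ρ')
  obtain ⟨η, hη, hηε⟩ : ∃ η : ℝ, 0 < η ∧ √(C * η ^ 2) * √K' < ε / 3 := by
    have hlim : Tendsto (fun η : ℝ => √(C * η ^ 2) * √K') (𝓝[>] 0) (𝓝 0) := by
      refine Tendsto.mono_left ?_ nhdsWithin_le_nhds
      exact Continuous.tendsto' (by fun_prop) _ _ (by simp)
    exact ((hlim.eventually (gt_mem_nhds (by positivity : 0 < ε / 3))).and
      self_mem_nhdsWithin).exists.imp fun _ h => h.symm
  obtain ⟨ψ, hψ⟩ := exists_continuous_integral_sq_sub_indicator_le ν hA hη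
  have hclose {μ : Measure (X × Z)} [IsFiniteMeasure μ] (hμ : μ.fst ≤ C • ν) {f : X × Z → ℝ}
      (hf : MemLp f 2 μ) (hfK : ∫ p, f p ^ 2 ∂μ ≤ K') :
      |∫ p in A ×ˢ Set.univ, f p ∂μ - ∫ p, ψ p.1 * f p ∂μ| < ε / 3 :=
    ((abs_setIntegral_sub_integral_continuous_mul_le hμ hf hA ψ).trans (by gcongr)).trans_lt hηε
  filter_upwards [Metric.tendsto_nhds.1 (h ψ) (ε / 3) (by positivity)] with k hk
  have h1 := abs_lt.1 (hclose (hρ k) (hg k) ((hgK k).trans (le_max_left _ _)))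
  have h2 := abs_lt.1 (hclose hρ' hg' (le_max_right _ _))
  rw [Real.dist_eq, abs_lt] at hk ⊢
  constructor <;> linarith [hk.1, hk.2, h1.1, h1.2, h2.1, h2.2]

theorem ae_le_of_tendsto_setIntegral {ι X : Type*} [Countable ι] {l : Filter ι} [l.NeBot]
    [MeasurableSpace X] {ν : Measure X} [IsFiniteMeasure ν] {S : ι → X → ℝ} {S' F : X → ℝ}
    (hS : ∀ k, Integrable (S k) ν) (hS' : Integrable S' ν)
    (h : ∀ A, MeasurableSet A → Tendsto (fun k => ∫ t in A, S k t ∂ν) l (𝓝 (∫ t in A, S' t ∂ν)))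
    (hF : ∀ k, ∀ᵐ t ∂ν, S k t ≤ F t) : ∀ᵐ t ∂ν, S' t ≤ F t := by
  let B (q : ℚ) : Set X := {t | ∀ k, (hS k).1.mk (S k) t ≤ q}
  have hB (q : ℚ) : MeasurableSet (B q) := by
    simp only [B, Set.ofPred_forall]
    exact MeasurableSet.iInter fun k =>
      (hS k).1.stronglyMeasurable_mk.measurable measurableSet_Iic
  have hmk : ∀ᵐ t ∂ν, ∀ k, S k t = (hS k).1.mk (S k) t := ae_all_iff.2 fun k => (hS k).1.ae_eq_mk
  have hq (q : ℚ) : ∀ᵐ t ∂ν, t ∈ B q → S' t ≤ q := by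
    rw [← ae_restrict_iff' (hB q)]
    refine ae_le_of_forall_setIntegral_le hS'.restrict (integrable_const _) fun A hA _ => ?_
    rw [Measure.restrict_restrict hA]
    refine le_of_tendsto' (h _ (hA.inter (hB q))) fun k => ?_
    refine setIntegral_mono_on_ae (hS k).integrableOn (integrable_const _).integrableOn
      (hA.inter (hB q)) (hmk.mono fun t ht htB => ?_)
    exact (ht k).trans_le (htB.2 k)
  filter_upwards [hmk, ae_all_iff.2 hF, ae_all_iff.2 hq] with t ht htF htq
  refine le_of_forall_gt_imp_ge_of_dense fun a ha => ?_
  obtain ⟨q, hqF, hqa⟩ := exists_rat_btwn ha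
  exact (htq q fun k => ht k ▸ (htF k).trans hqF.le).trans hqa.le

theorem ae_eq_of_tendsto_setIntegral {ι X : Type*} [Countable ι] {l : Filter ι} [l.NeBot]
    [MeasurableSpace X] {ν : Measure X} [IsFiniteMeasure ν] {S : ι → X → ℝ} {S' F : X → ℝ}
    (hS : ∀ k, Integrable (S k) ν) (hS' : Integrable S' ν)
    (h : ∀ A, MeasurableSet A → Tendsto (fun k => ∫ t in A, S k t ∂ν) l (𝓝 (∫ t in A, S' t ∂ν)))
    (hF : ∀ k, ∀ᵐ t ∂ν, S k t = F t) : ∀ᵐ t ∂ν, S' t = F t := by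
  have hle := ae_le_of_tendsto_setIntegral hS hS' h fun k => (hF k).mono fun _ ht => ht.le
  have hge := ae_le_of_tendsto_setIntegral (S := fun k t => -S k t) (S' := fun t => -S' t)
    (F := fun t => -F t) (fun k => (hS k).neg) hS'.neg
    (fun A hA => by simpa only [integral_neg] using (h A hA).neg)
    fun k => (hF k).mono fun _ ht => (congrArg Neg.neg ht).le
  filter_upwards [hle, hge] with t ht ht' using ht.antisymm (neg_le_neg_iff.1 ht')

end TimeSets

section Stability

theorem pairing_smul (δ c : ℝ) (h : ℝ × EuclideanSpace ℝ (Fin n) × ℝ) (u : Velocity n) :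
    pairing δ (c • h) u = c * pairing δ h u := by
  simp only [pairing, inner_dualVelocity, Prod.smul_fst, Prod.smul_snd, PiLp.smul_apply,
    smul_eq_mul, mul_add, Finset.mul_sum, mul_assoc]

theorem pairing_sq_le (δ : ℝ) (h : ℝ × EuclideanSpace ℝ (Fin n) × ℝ) (u : Velocity n) :
    pairing δ h u ^ 2 ≤ (h.1 ^ 2 + ‖dualVelocity δ h.2‖ ^ 2) * (1 + ‖u‖ ^ 2) := by
  have hpair : |pairing δ h u| ≤ |h.1| + ‖dualVelocity δ h.2‖ * ‖u‖ :=
    (abs_add_le _ _).trans (add_le_add_right (abs_real_inner_le_norm _ _) _)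
  calc pairing δ h u ^ 2 ≤ (|h.1| + ‖dualVelocity δ h.2‖ * ‖u‖) ^ 2 := sq_le_sq.2 <|
        hpair.trans (le_abs_self _)
    _ ≤ (|h.1| ^ 2 + ‖dualVelocity δ h.2‖ ^ 2) * (1 + ‖u‖ ^ 2) := by
        nlinarith [sq_nonneg (|h.1| * ‖u‖ - ‖dualVelocity δ h.2‖)]
    _ = (h.1 ^ 2 + ‖dualVelocity δ h.2‖ ^ 2) * (1 + ‖u‖ ^ 2) := by rw [sq_abs]

section

variable {Y : Type*}

theorem integral_pairing_sq_le [MeasurableSpace Y] {ρ : Measure Y} [IsFiniteMeasure ρ] {δ K : ℝ}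
    {h : Y → ℝ × EuclideanSpace ℝ (Fin n) × ℝ}
    (hK : ∀ y u, pairing δ (h y) u ^ 2 ≤ K * (1 + ‖u‖ ^ 2)) {u : Y → Velocity n}
    (hu : MemLp u 2 ρ) :
    ∫ y, pairing δ (h y) (u y) ^ 2 ∂ρ ≤ K * (ρ.real Set.univ + ∫ y, ‖u y‖ ^ 2 ∂ρ) := by
  have hsq : Integrable (fun y => ‖u y‖ ^ 2) ρ := hu.integrable_norm_pow two_ne_zero
  calc ∫ y, pairing δ (h y) (u y) ^ 2 ∂ρ ≤ ∫ y, K * (1 + ‖u y‖ ^ 2) ∂ρ :=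
        integral_mono_of_nonneg (ae_of_all _ fun _ => sq_nonneg _)
          (((integrable_const 1).add hsq).const_mul K) (ae_of_all _ fun y => hK y (u y))
    _ = K * (ρ.real Set.univ + ∫ y, ‖u y‖ ^ 2 ∂ρ) := by
        rw [integral_const_mul, integral_add (integrable_const 1) hsq, integral_const,
          smul_eq_mul, mul_one]

variable [TopologicalSpace Y] [CompactSpace Y]

theorem exists_pairing_sq_le (δ : ℝ) {h : Y → ℝ × EuclideanSpace ℝ (Fin n) × ℝ}
    (hh : Continuous h) : ∃ K, 0 ≤ K ∧ ∀ y u, pairing δ (h y) u ^ 2 ≤ K * (1 + ‖u‖ ^ 2) := by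
  have hcont : Continuous fun y => (h y).1 ^ 2 + ‖dualVelocity δ (h y).2‖ ^ 2 :=
    (hh.fst.pow 2).add (((continuous_dualVelocity δ).comp hh.snd).norm.pow 2)
  obtain ⟨K, hK⟩ := (isCompact_range hcont).bddAbove
  exact ⟨max K 0, le_max_right _ _, fun y u => (pairing_sq_le δ (h y) u).trans
    (mul_le_mul_of_nonneg_right ((hK ⟨y, rfl⟩).trans (le_max_left _ _)) (by positivity))⟩

variable [MeasurableSpace Y]

theorem memLp_pairing [OpensMeasurableSpace Y] {ρ : Measure Y} [IsFiniteMeasure ρ] (δ : ℝ)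
    {h : Y → ℝ × EuclideanSpace ℝ (Fin n) × ℝ} (hh : Continuous h) {u : Y → Velocity n}
    (hu : MemLp u 2 ρ) : MemLp (fun y => pairing δ (h y) (u y)) 2 ρ := by
  obtain ⟨K, -, hK⟩ := exists_pairing_sq_le δ hh
  have hmeas := (integrable_pairing δ hh (hu.integrable one_le_two)).1
  have hsq : Integrable (fun y => ‖u y‖ ^ 2) ρ := hu.integrable_norm_pow two_ne_zero
  exact (memLp_two_iff_integrable_sq hmeas).2 <|
    (((integrable_const 1).add hsq).const_mul K).mono' (hmeas.pow 2)
      (ae_of_all _ fun y => (Real.norm_of_nonneg (sq_nonneg _)).trans_le (hK y (u y)))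

theorem WeakTendsto.tendsto_integral_pairing [BorelSpace Y] {ι : Type*} {l : Filter ι}
    {ρ : ι → FiniteMeasure Y} {u : ι → Y → Velocity n} {ρ' : FiniteMeasure Y}
    {u' : Y → Velocity n} (hlim : WeakTendsto l ρ u ρ' u')
    (hu : ∀ k, Integrable (u k) (ρ k : Measure Y)) (hu' : Integrable u' (ρ' : Measure Y))
    (δ : ℝ) {h : Y → ℝ × EuclideanSpace ℝ (Fin n) × ℝ} (hh : Continuous h) :
    Tendsto (fun k => ∫ y, pairing δ (h y) (u k y) ∂(ρ k : Measure Y)) l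
      (𝓝 (∫ y, pairing δ (h y) (u' y) ∂(ρ' : Measure Y))) := by
  have hb : Continuous fun y => dualVelocity δ (h y).2 := (continuous_dualVelocity δ).comp hh.snd
  have hsplit (ν : FiniteMeasure Y) {v : Y → Velocity n} (hv : Integrable v (ν : Measure Y)) :
      ∫ y, pairing δ (h y) (v y) ∂(ν : Measure Y) = (∫ y, (h y).1 ∂(ν : Measure Y))
        + ∫ y, inner ℝ (dualVelocity δ (h y).2) (v y) ∂(ν : Measure Y) :=
    integral_add ((memLp_continuous ⟨_, hh.fst⟩ 1 _).integrable le_rfl)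
      (integrable_inner_continuous hb hv)
  rw [hsplit ρ' hu']
  refine Tendsto.congr (fun k => (hsplit (ρ k) (hu k)).symm) (Tendsto.add ?_ (hlim.field ⟨_, hb⟩))
  exact FiniteMeasure.tendsto_iff_forall_integral_tendsto.1 hlim.measure
    (BoundedContinuousFunction.mkOfCompact ⟨_, hh.fst⟩)

end

variable [CompactSpace Ω] {ι : Type*} {l : Filter ι} {ρ : ι → FiniteMeasure (I × Ω)}
  {u : ι → I × Ω → Velocity n} {ρ' : FiniteMeasure (I × Ω)} {u' : I × Ω → Velocity n}

theorem WeakTendsto.mem_CE [l.NeBot] (hlim : WeakTendsto l ρ u ρ' u')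
    (hu : ∀ k, Integrable (u k) (ρ k : Measure (I × Ω)))
    (hu' : Integrable u' (ρ' : Measure (I × Ω))) {δ : ℝ} {ρ₀ ρ₁ : FiniteMeasure Ω}
    (h : ∀ k, ofVelocity δ (ρ k) (u k) ∈ CE ρ₀ ρ₁) : ofVelocity δ ρ' u' ∈ CE ρ₀ ρ₁ := by
  refine (ofVelocity_mem_CE_iff hu').2 fun φ hφ => ?_
  refine tendsto_nhds_unique
    (hlim.tendsto_integral_pairing hu hu' δ (continuous_spaceTimeJet hφ)) ?_
  exact tendsto_const_nhds.congr fun k => ((ofVelocity_mem_CE_iff (hu k)).1 (h k) φ hφ).symm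

theorem WeakTendsto.tendsto_setIntegral_pairing (hlim : WeakTendsto l ρ u ρ' u') {C : NNReal}
    (hρ : ∀ k, (ρ k : Measure (I × Ω)).fst ≤ C • volume)
    (hρ' : (ρ' : Measure (I × Ω)).fst ≤ C • volume)
    (hu : ∀ k, MemLp (u k) 2 (ρ k : Measure (I × Ω))) (hu' : MemLp u' 2 (ρ' : Measure (I × Ω)))
    {E : ℝ} (hE : ∀ k, ∫ p, ‖u k p‖ ^ 2 ∂(ρ k : Measure (I × Ω)) ≤ E) (δ : ℝ)
    {h : I × Ω → ℝ × EuclideanSpace ℝ (Fin n) × ℝ} (hh : Continuous h) {A : Set I}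
    (hA : MeasurableSet A) :
    Tendsto (fun k => ∫ p in A ×ˢ Set.univ, pairing δ (h p) (u k p) ∂(ρ k : Measure (I × Ω))) l
      (𝓝 (∫ p in A ×ˢ Set.univ, pairing δ (h p) (u' p) ∂(ρ' : Measure (I × Ω)))) := by
  obtain ⟨K, hK0, hK⟩ := exists_pairing_sq_le δ hh
  have hmass (k : ι) : (ρ k : Measure (I × Ω)).real Set.univ ≤ C := by
    refine ENNReal.toReal_le_coe_of_le_coe ?_
    calc (ρ k : Measure (I × Ω)) Set.univ = (ρ k : Measure (I × Ω)).fst Set.univ :=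
          Measure.fst_univ.symm
      _ ≤ (C • volume : Measure I) Set.univ := hρ k _
      _ = C := by rw [Measure.smul_apply, measure_univ, ENNReal.smul_def, smul_eq_mul, mul_one]
  refine tendsto_setIntegral_of_tendsto_integral_continuous_mul (K := K * (C + E)) hρ
    (fun k => memLp_pairing δ hh (hu k))
    (fun k => (integral_pairing_sq_le hK (hu k)).trans
      (mul_le_mul_of_nonneg_left (add_le_add (hmass k) (hE k)) hK0))
    hρ' (memLp_pairing δ hh hu') (fun ψ => ?_) hA
  simpa only [pairing_smul] using
    hlim.tendsto_integral_pairing (fun k => (hu k).integrable one_le_two)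
      (hu'.integrable one_le_two) δ (h := fun p => ψ p.1 • h p) (by fun_prop)

theorem WeakTendsto.tendsto_setIntegral_slice (hlim : WeakTendsto l ρ u ρ' u') {C : NNReal}
    (hρ : ∀ k, (ρ k : Measure (I × Ω)).fst ≤ C • volume)
    (hρ' : (ρ' : Measure (I × Ω)).fst ≤ C • volume)
    (hu : ∀ k, MemLp (u k) 2 (ρ k : Measure (I × Ω))) (hu' : MemLp u' 2 (ρ' : Measure (I × Ω)))
    {E : ℝ} (hE : ∀ k, ∫ p, ‖u k p‖ ^ 2 ∂(ρ k : Measure (I × Ω)) ≤ E) (δ : ℝ)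
    {h : I × Ω → ℝ × EuclideanSpace ℝ (Fin n) × ℝ} (hh : Continuous h)
    {r : ι → I → FiniteMeasure Ω} (hr : ∀ k, IsDisintegration (ρ k) (r k))
    {r' : I → FiniteMeasure Ω} (hr' : IsDisintegration ρ' r') {A : Set I}
    (hA : MeasurableSet A) :
    Tendsto (fun k => ∫ t in A, ∫ x, pairing δ (h (t, x)) (u k (t, x)) ∂(r k t : Measure Ω)) l
      (𝓝 (∫ t in A, ∫ x, pairing δ (h (t, x)) (u' (t, x)) ∂(r' t : Measure Ω))) := by
  have hslice {ν : FiniteMeasure (I × Ω)} {s : I → FiniteMeasure Ω} (hs : IsDisintegration ν s)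
      {v : I × Ω → Velocity n} (hv : MemLp v 2 (ν : Measure (I × Ω))) :
      ∫ p in A ×ˢ Set.univ, pairing δ (h p) (v p) ∂(ν : Measure (I × Ω))
        = ∫ t in A, ∫ x, pairing δ (h (t, x)) (v (t, x)) ∂(s t : Measure Ω) := by
    simpa only [Measure.restrict_univ] using
      hs.setIntegral_prod (integrable_pairing δ hh (hv.integrable one_le_two)) hA .univ
  rw [← hslice hr' hu']
  exact (hlim.tendsto_setIntegral_pairing hρ hρ' hu hu' hE δ hh hA).congr
    fun k => hslice (hr k) (hu k)

theorem WeakTendsto.mem_Aff (hlim : WeakTendsto l ρ u ρ' u') {C : NNReal}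
    (hρ : ∀ k, (ρ k : Measure (I × Ω)).fst ≤ C • volume)
    (hρ' : (ρ' : Measure (I × Ω)).fst ≤ C • volume)
    (hum : ∀ k, StronglyMeasurable (u k)) (hum' : StronglyMeasurable u')
    (hu : ∀ k, MemLp (u k) 2 (ρ k : Measure (I × Ω))) (hu' : MemLp u' 2 (ρ' : Measure (I × Ω)))
    {E : ℝ} (hE : ∀ k, ∫ p, ‖u k p‖ ^ 2 ∂(ρ k : Measure (I × Ω)) ≤ E) {δ : ℝ}
    {h : I × Ω → ℝ × EuclideanSpace ℝ (Fin n) × ℝ} (hh : Continuous h) {F : I → ℝ}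
    {R : ℝ → ℝ → Prop}
    (hR : ∀ {S : ι → I → ℝ} {S' : I → ℝ}, (∀ k, Integrable (S k)) → Integrable S' →
      (∀ A, MeasurableSet A → Tendsto (fun k => ∫ t in A, S k t) l (𝓝 (∫ t in A, S' t))) →
      (∀ k, ∀ᵐ t, R (S k t) (F t)) → ∀ᵐ t, R (S' t) (F t))
    (hmem : ∀ k, ofVelocity δ (ρ k) (u k) ∈ Aff R h F) : ofVelocity δ ρ' u' ∈ Aff R h F := by
  have hiff k := ofVelocity_mem_Aff_iff (δ := δ) (R := R) (F := F) (hum k)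
    ((hu k).integrable one_le_two) hh
  choose r hr hrR using fun k => (hiff k).1 (hmem k)
  obtain ⟨r', hr'⟩ := exists_isDisintegration (Measure.absolutelyContinuous_of_le_smul hρ')
  have hint {ν : FiniteMeasure (I × Ω)} {s : I → FiniteMeasure Ω} (hs : IsDisintegration ν s)
      {v : I × Ω → Velocity n} (hv : MemLp v 2 (ν : Measure (I × Ω))) :
      Integrable fun t => ∫ x, pairing δ (h (t, x)) (v (t, x)) ∂(s t : Measure Ω) := by
    simpa only [Measure.restrict_univ] using
      hs.integrable_setIntegral (integrable_pairing δ hh (hv.integrable one_le_two)) .univ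
  exact (ofVelocity_mem_Aff_iff hum' (hu'.integrable one_le_two) hh).2
    ⟨r', hr', hR (fun k => hint (hr k) (hu k)) (hint hr' hu')
      (fun A hA => hlim.tendsto_setIntegral_slice hρ hρ' hu hu' hE δ hh hr hr' hA) hrR⟩

theorem WeakTendsto.mem_constrainedPaths [Countable ι] [l.NeBot] (hlim : WeakTendsto l ρ u ρ' u')
    (hum : ∀ k, StronglyMeasurable (u k)) (hum' : StronglyMeasurable u')
    (hu : ∀ k, MemLp (u k) 2 (ρ k : Measure (I × Ω))) (hu' : MemLp u' 2 (ρ' : Measure (I × Ω)))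
    {E : ℝ} (hE : ∀ k, ∫ p, ‖u k p‖ ^ 2 ∂(ρ k : Measure (I × Ω)) ≤ 2 * E)
    (hE' : ∫ p, ‖u' p‖ ^ 2 ∂(ρ' : Measure (I × Ω)) ≤ 2 * E) {δ : ℝ} {d d' : ℕ}
    {H : I × Ω → Fin d → ℝ × EuclideanSpace ℝ (Fin n) × ℝ} (hH : Continuous H)
    {F : I → Fin d → ℝ} {ρ₀ ρ₁ : FiniteMeasure Ω}
    (h : ∀ k, ofVelocity δ (ρ k) (u k) ∈ constrainedPaths d' H F ρ₀ ρ₁) :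
    ofVelocity δ ρ' u' ∈ constrainedPaths d' H F ρ₀ ρ₁ := by
  have hCE' : ofVelocity δ ρ' u' ∈ CE ρ₀ ρ₁ := hlim.mem_CE
    (fun k => (hu k).integrable one_le_two) (hu'.integrable one_le_two) fun k => (h k).1
  have hρ k := fst_le_of_mem_CE (hu k) (h k).1 (hE k)
  have hρ' := fst_le_of_mem_CE hu' hCE' hE'
  refine ⟨hCE', fun i hi => ?_, fun i hi => ?_⟩
  · exact hlim.mem_Aff hρ hρ' hum hum' hu hu' hE (by fun_prop) ae_le_of_tendsto_setIntegral
      fun k => (h k).2.1 i hi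
  · exact hlim.mem_Aff hρ hρ' hum hum' hu hu' hE (by fun_prop) ae_eq_of_tendsto_setIntegral
      fun k => (h k).2.2 i hi

end Stability

section Minimizer

theorem exists_minimizing_velocities {δ : ℝ} (hδ : δ ≠ 0) {d d' : ℕ}
    {H : I × Ω → Fin d → ℝ × EuclideanSpace ℝ (Fin n) × ℝ} {F : I → Fin d → ℝ}
    {ρ₀ ρ₁ : FiniteMeasure Ω} (h : wfrSq δ d' H F ρ₀ ρ₁ ≠ ⊤) :
    ∃ (ρ : ℕ → FiniteMeasure (I × Ω)) (u : ℕ → I × Ω → Velocity n),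
      (∀ k, StronglyMeasurable (u k)) ∧ (∀ k, MemLp (u k) 2 (ρ k : Measure (I × Ω))) ∧
      (∀ k, ofVelocity δ (ρ k) (u k) ∈ constrainedPaths d' H F ρ₀ ρ₁) ∧
      ∀ k : ℕ, ∫ p, ‖u k p‖ ^ 2 ∂(ρ k : Measure (I × Ω))
        ≤ 2 * ((wfrSq δ d' H F ρ₀ ρ₁).toReal + 1 / ((k : ℝ) + 1)) := by
  have hmin (k : ℕ) : ∃ μ ∈ constrainedPaths d' H F ρ₀ ρ₁,
      energy δ μ < wfrSq δ d' H F ρ₀ ρ₁ + ENNReal.ofReal (1 / ((k : ℝ) + 1)) := by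
    have hlt : wfrSq δ d' H F ρ₀ ρ₁
        < wfrSq δ d' H F ρ₀ ρ₁ + ENNReal.ofReal (1 / ((k : ℝ) + 1)) :=
      ENNReal.lt_add_right h (ENNReal.ofReal_pos.2 (by positivity)).ne'
    simpa only [wfrSq, iInf_lt_iff, exists_prop] using hlt
  choose μ hμ hμE using hmin
  have hfin (k : ℕ) : energy δ (μ k) < ⊤ :=
    (hμE k).trans (ENNReal.add_lt_top.2 ⟨h.lt_top, ENNReal.ofReal_lt_top⟩)
  refine ⟨fun k => (μ k).rho, fun k => velocity δ (μ k),
    fun k => stronglyMeasurable_velocity δ (μ k), fun k => memLp_velocity hδ (hfin k),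
    fun k => (ofVelocity_velocity hδ (hfin k)).symm ▸ hμ k, fun k => ?_⟩
  have hle := (hμE k).le
  rw [← ofVelocity_velocity hδ (hfin k),
    energy_ofVelocity_eq_ofReal hδ (memLp_velocity hδ (hfin k)),
    ← ENNReal.ofReal_toReal h, ← ENNReal.ofReal_add ENNReal.toReal_nonneg (by positivity),
    ENNReal.ofReal_le_ofReal_iff (by positivity)] at hle
  linarith

end Minimizer

end ConstrainedWFR

end

theorem theorem3p3_general {n d d' : ℕ} {Ω : Set (EuclideanSpace ℝ (Fin n))} (hΩ : IsCompact Ω)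
    {δ : ℝ} (hδ : δ ≠ 0) (ρ₀ ρ₁ : FiniteMeasure Ω)
    {H : I × Ω → Fin d → ℝ × EuclideanSpace ℝ (Fin n) × ℝ} (hH : Continuous H)
    (F : I → Fin d → ℝ) (hne : (ConstrainedWFR.constrainedPaths d' H F ρ₀ ρ₁).Nonempty) :
    ∃ μ ∈ ConstrainedWFR.constrainedPaths d' H F ρ₀ ρ₁,
      ConstrainedWFR.energy δ μ = ConstrainedWFR.wfrSq δ d' H F ρ₀ ρ₁ := by
  have := isCompact_iff_compactSpace.1 hΩ
  suffices ∃ μ ∈ ConstrainedWFR.constrainedPaths d' H F ρ₀ ρ₁,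
      ConstrainedWFR.energy δ μ ≤ ConstrainedWFR.wfrSq δ d' H F ρ₀ ρ₁ from
    this.imp fun μ h => ⟨h.1, h.2.antisymm (iInf₂_le μ h.1)⟩
  obtain htop | hfin := eq_or_ne (ConstrainedWFR.wfrSq δ d' H F ρ₀ ρ₁) ⊤
  · exact hne.imp fun μ hμ => ⟨hμ, le_top.trans_eq htop.symm⟩
  obtain ⟨ρ, u, hum, hu, hmem, hE⟩ := ConstrainedWFR.exists_minimizing_velocities hδ hfin
  set m := (ConstrainedWFR.wfrSq δ d' H F ρ₀ ρ₁).toReal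
  have hE1 (k : ℕ) : ∫ p, ‖u k p‖ ^ 2 ∂(ρ k : Measure (I × Ω)) ≤ 2 * (m + 1) :=
    (hE k).trans (by gcongr; exact (div_le_one₀ (by positivity)).2 (by simp))
  have hmass (k : ℕ) : (ρ k).mass ≤ _ :=
    NNReal.le_toNNReal_of_coe_le (ConstrainedWFR.mass_le_of_mem_CE (hu k) (hmem k).1 (hE1 k))
  have hlim : Filter.Tendsto (fun k : ℕ => 2 * (m + 1 / ((k : ℝ) + 1)))
      (Filter.hyperfilter ℕ) (nhds (2 * m)) := by
    simpa using ((tendsto_one_div_add_atTop_nhds_zero_nat.const_add m).const_mul 2).mono_left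
      Nat.hyperfilter_le_atTop
  obtain ⟨ρ', u', hum', hu', hE', hweak⟩ :=
    ConstrainedWFR.exists_weakTendsto (Filter.hyperfilter ℕ) hu hmass hlim hE
  refine ⟨_, hweak.mem_constrainedPaths hum hum' hu hu' hE1 (hE'.trans (by linarith)) hH hmem, ?_⟩
  rw [ConstrainedWFR.energy_ofVelocity_eq_ofReal hδ hu', ← ENNReal.ofReal_toReal hfin]
  exact ENNReal.ofReal_le_ofReal (by linarith)

theorem theorem3p3 {n d d' : ℕ} (hd : d' ≤ d)
    (Ω : Set (EuclideanSpace ℝ (Fin n))) (hΩ : IsCompact Ω)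
    (δ : ℝ) (hδ : 0 < δ) (ρ₀ ρ₁ : FiniteMeasure Ω)
    (H : I × Ω → Fin d → ℝ × EuclideanSpace ℝ (Fin n) × ℝ) (hH : Continuous H)
    (F : I → Fin d → ℝ) (hF : Continuous F)
    (hfeas : ∃ μ ∈ ConstrainedWFR.constrainedPaths d' H F ρ₀ ρ₁,
      ConstrainedWFR.energy δ μ < ⊤) :
    ∃ μ ∈ ConstrainedWFR.constrainedPaths d' H F ρ₀ ρ₁,
      ConstrainedWFR.energy δ μ = ConstrainedWFR.wfrSq δ d' H F ρ₀ ρ₁ :=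
  theorem3p3_general hΩ hδ.ne' ρ₀ ρ₁ hH F (hfeas.imp fun _ h => h.1)
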